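/- Let $Sm/\mathbb C$ be the category of smooth schemes of finite type over $\mathbb C$ with the Nisnevich topology. For a sheaf of sets $\mathcal F$ on $Sm/\mathbb C$, let $\mathcal S(\mathcal F)$ be the Nisnevich sheafification of the presheaf $U\mapsto \mathcal F(U)/\!\sim$, where $\sim$ is the equivalence relation generated by $\mathbb A^1$-homotopy: $x_0,x_1\in\mathcal F(U)$ are $\mathbb A^1$-homotopic if there is $h\in\mathcal F(\mathbb A^1_{\mathbb C}\times U)$ whose restrictions along the sections $0$ and $1$ of $\mathbb A^1_{\mathbb C}\times U\to U$ are $x_0$ and $x_1$. Put $\mathcal S^0(\mathcal F)=\mathcal F$ and $\mathcal S^{n+1}(\mathcal F)=\mathcal S(\mathcal S^n(\mathcal F))$; there is a canonical morphism $\mathcal S^n(\mathcal F)\to\mathcal S^{n+1}(\mathcal F)$. A scheme $Z\in Sm/\mathbb C$ is identified with the sheaf it represents. **Proposition.** For every integer $n\ge 0$ there exists a smooth variety $Z_n$ over $\mathbb C$ (an integral, separated, smooth scheme of finite type over $\mathbb C$) such that $\mathcal S^n(Z_n)(\mathbb C)\neq\mathcal S^{n+1}(Z_n)(\mathbb C)$;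 precisely, the canonical map $\mathcal S^n(Z_n)(\mathbb C)\to\mathcal S^{n+1}(Z_n)(\mathbb C)$ is not injective. -/

import Mathlib

open CategoryTheory Opposite

universe u

noncomputable section

namespace AOne

open AlgebraicGeometry CategoryTheory.Limits

/-- The category of smooth schemes of finite type over the field `k`, with all morphisms
of `k`-schemes. (A smooth morphism is locally of finite presentation, so "of finite type" means
"quasi-compact" here.) -/
abbrev Sm (k : Type u) [Field k] : Type (u + 1) :=
  MorphismProperty.Over (@Smooth ⊓ @QuasiCompact : MorphismProperty Scheme.{u}) ⊤
    (Spec (CommRingCat.of k))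

section

variable {k : Type u} [Field k]

/-- The object of `Sm k` given by a smooth morphism of finite type to `Spec k`. -/
abbrev Sm.mk {X : Scheme.{u}} (p : X ⟶ Spec (CommRingCat.of k)) (hp : Smooth p)
    (hp' : QuasiCompact p) : Sm k :=
  MorphismProperty.Over.mk ⊤ p ⟨hp, hp'⟩

lemma Sm.smooth (X : Sm k) : Smooth X.hom := X.prop.1

lemma Sm.quasiCompact (X : Sm k) : QuasiCompact X.hom := X.prop.2

variable (k) in
/-- The final object `Spec k` of `Sm k`. -/
def Sm.point : Sm k := Sm.mk (𝟙 (Spec (CommRingCat.of k))) inferInstance inferInstance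

/-! ### The Nisnevich topology -/

/-- `f : U ⟶ X` is étale, and some point `u` of `U` lies over `x` with trivial
residue field extension `κ(x) = κ(u)`. -/
def IsNisnevichAt {U X : Scheme.{u}} (f : U ⟶ X) (x : X) : Prop :=
  Etale f ∧ ∃ u : U, f u = x ∧ IsIso (f.residueFieldMap u)

lemma IsNisnevichAt.id {X : Scheme.{u}} (x : X) : IsNisnevichAt (𝟙 X) x :=
  ⟨inferInstance, x, rfl, inferInstance⟩

lemma IsNisnevichAt.comp {V U X : Scheme.{u}} {g : V ⟶ U} {f : U ⟶ X} {u : U} {v : V}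
    (hf : Etale f) (hf' : IsIso (f.residueFieldMap u)) (hg : Etale g) (hv : g v = u)
    (hg' : IsIso (g.residueFieldMap v)) : IsNisnevichAt (g ≫ f) (f u) := by
  subst hv
  refine ⟨inferInstance, v, by simp, ?_⟩
  rw [Scheme.residueFieldMap_comp]
  exact IsIso.comp_isIso' hf' hg'

lemma IsNisnevichAt.baseChange {U X Y : Scheme.{u}} {f : U ⟶ X} (g : Y ⟶ X) {y : Y}
    (hf : IsNisnevichAt f (g y)) : IsNisnevichAt (pullback.snd f g) y := by
  obtain ⟨hf, u, hu, hi⟩ := hf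
  refine ⟨inferInstance, ?_⟩
  let a : Spec (Y.residueField y) ⟶ U :=
    Spec.map (inv (f.residueFieldMap u) ≫ (X.residueFieldCongr hu).hom ≫ g.residueFieldMap y) ≫
      U.fromSpecResidueField u
  have ha : a ≫ f = Y.fromSpecResidueField y ≫ g := by
    simp only [a, Category.assoc, ← Scheme.Hom.SpecMap_residueFieldMap_fromSpecResidueField,
      Spec.map_comp, ← Scheme.residueFieldCongr_fromSpecResidueField hu]
    rw [← Spec.map_comp_assoc (f.residueFieldMap u), IsIso.hom_inv_id]
    simp
  let σ : Spec (CommRingCat.of (Y.residueField y)) ⟶ pullback f g :=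
    pullback.lift a (Y.fromSpecResidueField y) ha
  have hσ : σ ≫ pullback.snd f g = Y.fromSpecResidueField y := pullback.lift_snd _ _ _
  let w : ↥(pullback f g) := σ (IsLocalRing.closedPoint (Y.residueField y))
  have hw : pullback.snd f g w = y := by
    have h (z) : pullback.snd f g (σ z) = y := by
      rw [← Scheme.Hom.comp_apply, hσ]
      exact Scheme.fromSpecResidueField_apply _ _
    exact h _
  let d : (pullback f g).residueField w ⟶ CommRingCat.of (Y.residueField y) :=
    (Scheme.SpecToEquivOfField (Y.residueField y) (pullback f g) σ).2
  have hd : Spec.map d ≫ (pullback f g).fromSpecResidueField w = σ :=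
    (Scheme.SpecToEquivOfField (Y.residueField y) (pullback f g)).symm_apply_apply σ
  have key : (pullback.snd f g).residueFieldMap w ≫ d = (Y.residueFieldCongr hw).hom := by
    rw [← Spec.map_inj, ← cancel_mono (Y.fromSpecResidueField _), Spec.map_comp, Category.assoc,
      Scheme.Hom.SpecMap_residueFieldMap_fromSpecResidueField, reassoc_of% hd, hσ,
      Scheme.residueFieldCongr_fromSpecResidueField]
  refine ⟨w, hw, ?_⟩
  have hd' : IsIso d := by
    rw [ConcreteCategory.isIso_iff_bijective]
    refine ⟨d.hom.injective, fun z ↦ ?_⟩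
    refine ⟨(pullback.snd f g).residueFieldMap w ((Y.residueFieldCongr hw).inv z), ?_⟩
    rw [← CommRingCat.comp_apply, key, ← CommRingCat.comp_apply, Iso.inv_hom_id,
      CommRingCat.id_apply]
  exact IsIso.of_isIso_fac_right key

/-- The Nisnevich topology on `Sm k`: a sieve on `X` is covering if and only if for every point `x`
of `X` it contains an étale morphism `f : U ⟶ X` such that some point of `U` over `x` has the same
residue field as `x`. -/
def nisnevich (k : Type u) [Field k] : GrothendieckTopology (Sm k) where
  sieves X := {S | ∀ x : X.left, ∃ (U : Sm k) (f : U ⟶ X), S f ∧ IsNisnevichAt f.left x}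
  top_mem' X x := ⟨X, 𝟙 X, trivial, IsNisnevichAt.id x⟩
  pullback_stable' X Y S g hS y := by
    obtain ⟨U, f, hSf, hf⟩ := hS (g.left y)
    have := hf.1
    have := Y.smooth
    have := Y.quasiCompact
    have := U.smooth
    have := U.quasiCompact
    have : IsLocallyNoetherian U.left :=
      LocallyOfFiniteType.isLocallyNoetherian (Y := Spec (CommRingCat.of k)) U.hom
    have : CompactSpace U.left :=
      QuasiCompact.compactSpace_of_compactSpace (Y := Spec (CommRingCat.of k)) U.hom
    have : IsNoetherian U.left := {}
    have : QuasiCompact f.left := inferInstance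
    refine ⟨Sm.mk (pullback.snd f.left g.left ≫ Y.hom) inferInstance inferInstance,
      MorphismProperty.Over.homMk (pullback.snd f.left g.left) rfl trivial, ?_,
      hf.baseChange g.left⟩
    let q : Sm.mk (pullback.snd f.left g.left ≫ Y.hom) inferInstance inferInstance ⟶ U :=
      MorphismProperty.Over.homMk (pullback.fst f.left g.left) (by
        change pullback.fst f.left g.left ≫ U.hom = pullback.snd f.left g.left ≫ Y.hom
        rw [← MorphismProperty.Over.w f, ← MorphismProperty.Over.w g, pullback.condition_assoc]) trivial
    have hq : MorphismProperty.Over.homMk (pullback.snd f.left g.left) rfl trivial ≫ g = q ≫ f := by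
      ext : 1
      exact pullback.condition.symm
    change S (_ ≫ g)
    rw [hq]
    exact S.downward_closed hSf q
  transitive' X S hS R hR x := by
    obtain ⟨U, f, hSf, hf, u, hu, hi⟩ := hS x
    obtain ⟨V, g, hg, hg₁, v, hv, hj⟩ := hR hSf u
    refine ⟨V, g ≫ f, hg, ?_⟩
    subst hu
    exact IsNisnevichAt.comp hf hi hg₁ hv hj

/-! ### The affine line over a smooth scheme and its sections -/

open scoped AlgebraicGeometry in
lemma smooth_line (X : Scheme.{u}) : Smooth (𝔸(PUnit.{u + 1}; X) ↘ X) := by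
  have h₁ := isIso_of_isTerminal specULiftZIsTerminal.{u} terminalIsTerminal (terminal.from _)
  have h₂ : Smooth (Spec.map (CommRingCat.ofHom
      (MvPolynomial.C : ULift.{u} ℤ →+* MvPolynomial PUnit.{u + 1} (ULift.{u} ℤ)))) := by
    rw [HasRingHomProperty.Spec_iff (P := @Smooth)]
    exact RingHom.smooth_algebraMap.mpr {}
  have h₃ : Smooth (terminal.from
      (Spec (CommRingCat.of (MvPolynomial PUnit.{u + 1} (ULift.{u} ℤ))))) := by
    rw [← terminal.comp_from (Spec.map (CommRingCat.ofHom MvPolynomial.C))]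
    infer_instance
  exact inferInstanceAs (Smooth (pullback.fst _ _))

open scoped AlgebraicGeometry in
/-- The endofunctor `U ↦ 𝔸¹ × U` of `Sm k`. -/
def line (k : Type u) [Field k] : Sm k ⥤ Sm k where
  obj U := Sm.mk (𝔸(PUnit.{u + 1}; U.left) ↘ U.left ≫ U.hom)
    (have := U.smooth; have := smooth_line U.left; inferInstance)
    (have := U.quasiCompact; inferInstance)
  map f := MorphismProperty.Over.homMk (AffineSpace.map PUnit.{u + 1} f.left)
    ((AffineSpace.map_over_assoc _ _).trans
      (congrArg (𝔸(PUnit.{u + 1}; _) ↘ _ ≫ ·) (MorphismProperty.Over.w f))) trivial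
  map_id U := by
    ext : 1
    exact AffineSpace.map_id _
  map_comp f g := by
    ext : 1
    exact AffineSpace.map_comp _ _

lemma constSection_naturality {X Y : Scheme.{u}} (f : X ⟶ Y) (c : ∀ X : Scheme.{u}, Γ(X, ⊤))
    (hc : f.appTop (c Y) = c X) :
    f ≫ AffineSpace.homOfVector (n := PUnit.{u + 1}) (𝟙 Y) (fun _ ↦ c Y) =
      AffineSpace.homOfVector (𝟙 X) (fun _ ↦ c X) ≫ AffineSpace.map PUnit.{u + 1} f := by
  refine AffineSpace.hom_ext ?_ fun i ↦ ?_
  · simp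
  · rw [Scheme.Hom.comp_appTop, Scheme.Hom.comp_appTop, CommRingCat.comp_apply,
      CommRingCat.comp_apply, AffineSpace.map_appTop_coord, AffineSpace.homOfVector_appTop_coord,
      AffineSpace.homOfVector_appTop_coord, hc]

/-- The section `u ↦ (0, u)`. -/
def zeroSection (k : Type u) [Field k] : 𝟭 (Sm k) ⟶ line k where
  app U := MorphismProperty.Over.homMk (AffineSpace.homOfVector (𝟙 U.left) (fun _ ↦ 0))
    (AffineSpace.homOfVector_over_assoc _ _ _) trivial
  naturality U V f := by
    ext : 1
    exact constSection_naturality f.left (fun X ↦ 0) (map_zero _)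

/-- The section `u ↦ (1, u)`. -/
def oneSection (k : Type u) [Field k] : 𝟭 (Sm k) ⟶ line k where
  app U := MorphismProperty.Over.homMk (AffineSpace.homOfVector (𝟙 U.left) (fun _ ↦ 1))
    (AffineSpace.homOfVector_over_assoc _ _ _) trivial
  naturality U V f := by
    ext : 1
    exact constSection_naturality f.left (fun X ↦ 1) (map_one _)

/-! ### Naive `𝔸¹`-connected components -/

/-- Presheaves of sets on `Sm k`. The sets are taken one universe up, so that `Sm k` is small
relative to them and the sheafification exists. -/
abbrev Psh (k : Type u) [Field k] : Type _ := (Sm k)ᵒᵖ ⥤ Type (u + 1)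

/-- The presheaf of sets `U ↦ Hom(U, X)` represented by a smooth scheme `X`. -/
abbrev represented (X : Sm k) : Psh k := uliftYoneda.{u + 1}.obj X

/-- Sections `x₀, x₁ ∈ F(U)` are `𝔸¹`-homotopic if some `h ∈ F(𝔸¹ × U)` has `h(0) = x₀` and
`h(1) = x₁`. -/
def Homotopic (F : Psh k) (U : (Sm k)ᵒᵖ) (x₀ x₁ : F.obj U) : Prop :=
  ∃ h : F.obj (op ((line k).obj U.unop)),
    F.map ((zeroSection k).app U.unop).op h = x₀ ∧ F.map ((oneSection k).app U.unop).op h = x₁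

lemma Homotopic.map (F : Psh k) {U V : (Sm k)ᵒᵖ} (f : U ⟶ V) {x₀ x₁ : F.obj U}
    (h : Homotopic F U x₀ x₁) : Homotopic F V (F.map f x₀) (F.map f x₁) := by
  obtain ⟨h, rfl, rfl⟩ := h
  refine ⟨F.map ((line k).map f.unop).op h, ?_, ?_⟩
  · have := (zeroSection k).naturality f.unop
    simp only [← Functor.map_comp_apply, ← op_comp, ← this]
    rfl
  · have := (oneSection k).naturality f.unop
    simp only [← Functor.map_comp_apply, ← op_comp, ← this]
    rfl

/-- The presheaf `U ↦ F(U)/∼`, where `∼` is the equivalence relation generated by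
`𝔸¹`-homotopy. -/
def naivePre (F : Psh k) : Psh k where
  obj X := Quot (Homotopic F X)
  map f := TypeCat.ofHom (Quot.map (F.map f) fun _ _ ↦ Homotopic.map F f)
  map_id _ := by
    ext ⟨x⟩
    exact congrArg (Quot.mk _) (by simp)
  map_comp f g := by
    ext ⟨x⟩
    exact congrArg (Quot.mk _) (by simp)

/-- The quotient map `F(U) → F(U)/∼`. -/
def toNaivePre (F : Psh k) : F ⟶ naivePre F where
  app _ := TypeCat.ofHom (Quot.mk _)
  naturality _ _ _ := rfl

/-- The sheaf `𝒮(F)` of naive `𝔸¹`-connected components of `F`: the Nisnevich sheafification of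
`U ↦ F(U)/∼`. -/
def naive (F : Psh k) : Psh k := sheafify (nisnevich k) (naivePre F)

/-- The canonical morphism `F ⟶ 𝒮(F)`. -/
def toNaive (F : Psh k) : F ⟶ naive F := toNaivePre F ≫ toSheafify (nisnevich k) (naivePre F)

/-- The iterates: `𝒮⁰(F) = F` and `𝒮ⁿ⁺¹(F) = 𝒮(𝒮ⁿ(F))`. -/
def naiveIter (F : Psh k) : ℕ → Psh k
  | 0 => F
  | n + 1 => naive (naiveIter F n)

/-- The canonical morphism `𝒮ⁿ(F) ⟶ 𝒮ⁿ⁺¹(F)`. -/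
def naiveIterSucc (F : Psh k) (n : ℕ) : naiveIter F n ⟶ naiveIter F (n + 1) :=
  toNaive (naiveIter F n)

end

end AOne

end

/-!
For a system `P` of polynomial equations let `zeros k P` be the Nisnevich sheaf on `Sm k` sending `U`
to the solutions of `P` in the ring of regular functions on `U`. It is represented by an affine
scheme that may well be singular, and the proof first works with such sheaves.

The basic example is the surface `Y : (t y - 1) ((t - 1) x - 1) = 0`, mapped to the line by `t`. It
is the union of `{t ≠ 0} × 𝔸¹` and `{t ≠ 1} × 𝔸¹`, glued along a curve closed in both. Since `t` or
`t - 1` is invertible along any line in `Y`, and units of a polynomial ring over a field are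
constant, homotopies in `Y` do not move `t` (`pull_zero_eq_pull_one_of_mul_eq_zero`). On the other
hand `Y` has sections over `t ≠ 0` and over `t ≠ 1`, and there any two sections are chain homotopic
(`exists_lift_breakup`). Hence `𝒮(Y)` is the affine line. Pulling back a copy of `Y` along every
coordinate of an affine scheme gives a system `breakup P` with `𝒮(zeros (breakup P)) ≅ zeros P`
(`nonempty_naive_breakup_iso`). Breaking up the affine line `n` times therefore yields a system `P`
for which `𝒮ⁿ(zeros P)` is the affine line, whose points `0` and `1` are distinct but homotopic
(`exists_collapses_naiveIter`).

To pass to a smooth variety, let `Z` be the open subscheme of affine space on which all `1 + P i`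
are invertible. These functions map `Z` to a power of the multiplicative group, a rigid sheaf, with
fibre `zeros P` over `1`. As homotopies cannot leave a fibre of a map to a rigid sheaf, `𝒮`
preserves fibre products over such sheaves (`exists_isPullback_naiveMap`), so that `𝒮ⁿ(zeros P)`
embeds into `𝒮ⁿ(Z)` (`Collapses.of_isPullback`), and two distinct points of `𝒮ⁿ(Z)` are identified
in `𝒮ⁿ⁺¹(Z)`.

Two facts about smooth schemes enter: they are reduced (`Sm.isReduced`), and regular functions
satisfy Nisnevich descent (`Fn.exists_glue`), which follows from fppf descent.
-/

noncomputable section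

namespace AOne

open AlgebraicGeometry CategoryTheory.Limits

section

variable {k : Type u} [Field k]

/-! ### Functoriality of naive `𝔸¹`-connected components -/

lemma Homotopic.natTrans {F G : Psh k} (φ : F ⟶ G) {U : (Sm k)ᵒᵖ} {x₀ x₁ : F.obj U}
    (h : Homotopic F U x₀ x₁) : Homotopic G U (φ.app U x₀) (φ.app U x₁) := by
  obtain ⟨h, rfl, rfl⟩ := h
  exact ⟨φ.app _ h, (NatTrans.naturality_apply φ _ _).symm, (NatTrans.naturality_apply φ _ _).symm⟩

/-- The map `F(U)/∼ → G(U)/∼` induced by a morphism of presheaves `F ⟶ G`. -/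
def naivePreMap {F G : Psh k} (φ : F ⟶ G) : naivePre F ⟶ naivePre G where
  app U := TypeCat.ofHom (Quot.map (φ.app U) fun _ _ ↦ Homotopic.natTrans φ)
  naturality U V f := by
    ext ⟨x⟩
    exact congrArg (Quot.mk _) (NatTrans.naturality_apply φ f x)

/-- The morphism `𝒮(F) ⟶ 𝒮(G)` induced by a morphism of presheaves `F ⟶ G`. -/
def naiveMap {F G : Psh k} (φ : F ⟶ G) : naive F ⟶ naive G :=
  sheafifyMap (nisnevich k) (naivePreMap φ)

lemma toNaive_naturality {F G : Psh k} (φ : F ⟶ G) :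
    toNaive F ≫ naiveMap φ = φ ≫ toNaive G := by
  have : toNaivePre F ≫ naivePreMap φ = φ ≫ toNaivePre G := rfl
  refine (Category.assoc _ _ _).trans ?_
  refine (congrArg (toNaivePre F ≫ ·) (toSheafify_naturality _ (naivePreMap φ)).symm).trans ?_
  refine (Category.assoc _ _ _).symm.trans ?_
  refine (congrArg (· ≫ toSheafify (nisnevich k) _) this).trans ?_
  exact Category.assoc _ _ _

lemma naiveMap_id (F : Psh k) : naiveMap (𝟙 F) = 𝟙 _ := by
  have : naivePreMap (𝟙 F) = 𝟙 _ := by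
    ext U ⟨x⟩
    rfl
  rw [naiveMap, this, sheafifyMap_id]
  rfl

lemma naiveMap_comp {F G H : Psh k} (φ : F ⟶ G) (ψ : G ⟶ H) :
    naiveMap (φ ≫ ψ) = naiveMap φ ≫ naiveMap ψ := by
  have : naivePreMap (φ ≫ ψ) = naivePreMap φ ≫ naivePreMap ψ := by
    ext U ⟨x⟩
    rfl
  rw [naiveMap, this, sheafifyMap_comp]
  rfl

lemma toNaive_eq_of_homotopic {F : Psh k} {U : (Sm k)ᵒᵖ} {x₀ x₁ : F.obj U}
    (h : Homotopic F U x₀ x₁) : (toNaive F).app U x₀ = (toNaive F).app U x₁ :=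
  congrArg ((toSheafify (nisnevich k) (naivePre F)).app U) (Quot.sound h)

/-- The isomorphism `𝒮(F) ≅ 𝒮(G)` induced by an isomorphism of presheaves `F ≅ G`. -/
def naiveIso {F G : Psh k} (e : F ≅ G) : naive F ≅ naive G where
  hom := naiveMap e.hom
  inv := naiveMap e.inv
  hom_inv_id := by rw [← naiveMap_comp, e.hom_inv_id, naiveMap_id]
  inv_hom_id := by rw [← naiveMap_comp, e.inv_hom_id, naiveMap_id]

/-- The morphism `𝒮ⁿ(F) ⟶ 𝒮ⁿ(G)` induced by a morphism of presheaves `F ⟶ G`. -/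
def naiveIterMap {F G : Psh k} (φ : F ⟶ G) : ∀ n, naiveIter F n ⟶ naiveIter G n
  | 0 => φ
  | n + 1 => naiveMap (naiveIterMap φ n)

/-- `𝒮ⁿ(F) ≅ 𝒮ⁿ(G)` for isomorphic presheaves `F ≅ G`. -/
def naiveIterIso {F G : Psh k} (e : F ≅ G) : ∀ n, naiveIter F n ≅ naiveIter G n
  | 0 => e
  | n + 1 => naiveIso (naiveIterIso e n)

/-- The functor `𝒮` may be iterated from either side. -/
lemma naiveIter_succ' (F : Psh k) (n : ℕ) : naiveIter F (n + 1) = naiveIter (naive F) n := by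
  induction n with
  | zero => rfl
  | succ n ih => exact congrArg naive ih

/-- The map `F(k) → 𝒮(F)(k)` identifies two different points. -/
def Collapses (F : Psh k) : Prop :=
  ¬ Function.Injective ((toNaive F).app (op (Sm.point k)))

lemma Collapses.of_injective {F G : Psh k} (φ : F ⟶ G)
    (hφ : Function.Injective (φ.app (op (Sm.point k)))) (h : Collapses F) : Collapses G := by
  intro hG
  refine h fun x y hxy ↦ hφ (hG ?_)
  have := congrArg ((naiveMap φ).app (op (Sm.point k))) hxy
  simp only [← NatTrans.comp_app_apply, toNaive_naturality] at this
  exact this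

lemma Collapses.of_iso {F G : Psh k} (e : F ≅ G) (h : Collapses F) : Collapses G :=
  h.of_injective e.hom (injective_of_mono _)

lemma Collapses.naiveIter_succ {F G : Psh k} (e : naive F ≅ G) {n : ℕ}
    (h : Collapses (naiveIter G n)) : Collapses (naiveIter F (n + 1)) := by
  rw [naiveIter_succ']
  exact h.of_iso (naiveIterIso e.symm n)

/-! ### Regular functions and the affine line -/

/-- The ring of regular functions on a smooth scheme. -/
abbrev Fn (U : Sm k) : Type u := Γ(U.left, ⊤)

/-- Pullback of regular functions. -/
def pull {U V : Sm k} (f : V ⟶ U) : Fn U →+* Fn V := f.left.appTop.hom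

lemma pull_id (U : Sm k) : pull (𝟙 U) = RingHom.id _ := by
  ext x
  exact congr($(Scheme.Hom.id_appTop (X := U.left)).hom x)

lemma pull_comp {U V W : Sm k} (f : V ⟶ U) (g : W ⟶ V) : pull (g ≫ f) = (pull g).comp (pull f) := by
  ext x
  exact congr($(Scheme.Hom.comp_appTop g.left f.left).hom x)

lemma pull_pull {U V W : Sm k} (f : V ⟶ U) (g : W ⟶ V) (x : Fn U) :
    pull g (pull f x) = pull (g ≫ f) x := by
  rw [pull_comp]
  rfl

/-- The projection `𝔸¹ × U ⟶ U`. -/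
def lineProj (U : Sm k) : (line k).obj U ⟶ U :=
  MorphismProperty.Over.homMk (AffineSpace.over PUnit.{u + 1} U.left).hom rfl trivial

/-- The coordinate function on `𝔸¹ × U`. -/
def lineCoord (U : Sm k) : Fn ((line k).obj U) := AffineSpace.coord U.left PUnit.unit

/-- The morphism `V ⟶ 𝔸¹ × U` with components `a` and `f`. -/
def lineLift {U V : Sm k} (f : V ⟶ U) (a : Fn V) : V ⟶ (line k).obj U :=
  MorphismProperty.Over.homMk (AffineSpace.homOfVector f.left fun _ ↦ a)
    ((AffineSpace.homOfVector_over_assoc _ _ _).trans (MorphismProperty.Over.w f)) trivial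

@[simp]
lemma lineLift_lineProj {U V : Sm k} (f : V ⟶ U) (a : Fn V) : lineLift f a ≫ lineProj U = f := by
  ext : 1
  exact AffineSpace.homOfVector_over _ _

@[simp]
lemma lineLift_lineProj_assoc {U V W : Sm k} (f : V ⟶ U) (a : Fn V) (g : U ⟶ W) :
    lineLift f a ≫ lineProj U ≫ g = f ≫ g := by
  rw [← Category.assoc, lineLift_lineProj]

@[simp]
lemma pull_lineLift_lineCoord {U V : Sm k} (f : V ⟶ U) (a : Fn V) :
    pull (lineLift f a) (lineCoord U) = a :=
  AffineSpace.homOfVector_appTop_coord _ _ _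

lemma line_hom_ext {U V : Sm k} {f g : V ⟶ (line k).obj U}
    (h₁ : f ≫ lineProj U = g ≫ lineProj U)
    (h₂ : pull f (lineCoord U) = pull g (lineCoord U)) : f = g := by
  ext : 1
  exact AffineSpace.hom_ext congr(($h₁).left) fun _ ↦ h₂

lemma zeroSection_app (U : Sm k) : (zeroSection k).app U = lineLift (𝟙 U) 0 := rfl

lemma oneSection_app (U : Sm k) : (oneSection k).app U = lineLift (𝟙 U) 1 := rfl

/-- A morphism `𝔸¹ × U ⟶ 𝔸¹ × U` over `U` varying with a parameter in `𝔸¹`: it contracts the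
line to the zero section at parameter `0` and is the identity at parameter `1`. -/
def lineMul (U : Sm k) : (line k).obj ((line k).obj U) ⟶ (line k).obj U :=
  lineLift (lineProj _ ≫ lineProj U) (lineCoord _ * pull (lineProj _) (lineCoord U))

lemma zeroSection_lineMul (U : Sm k) :
    (zeroSection k).app ((line k).obj U) ≫ lineMul U = lineProj U ≫ (zeroSection k).app U := by
  refine line_hom_ext ?_ ?_
  · simp [zeroSection_app, lineMul]
  · simp [← pull_pull, zeroSection_app, lineMul]

lemma oneSection_lineMul (U : Sm k) :
    (oneSection k).app ((line k).obj U) ≫ lineMul U = 𝟙 _ := by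
  refine line_hom_ext ?_ ?_
  · simp [oneSection_app, lineMul]
  · simp [← pull_pull, oneSection_app, lineMul]
    simp [pull_pull]

/-! ### Rigid presheaves -/

/-- `G` is `𝔸¹`-rigid: homotopic sections are equal. See `IsRigid.map_lineProj` for the stronger
statement that `G(U) → G(𝔸¹ × U)` is bijective. -/
def IsRigid (G : Psh k) : Prop :=
  ∀ (U : (Sm k)ᵒᵖ) (x₀ x₁ : G.obj U), Homotopic G U x₀ x₁ → x₀ = x₁

/-- If `φ` does not separate homotopic sections, it factors through `naivePre F`. -/
def naivePreDesc {F G : Psh k} (φ : F ⟶ G)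
    (hφ : ∀ (U : (Sm k)ᵒᵖ) (x₀ x₁ : F.obj U), Homotopic F U x₀ x₁ → φ.app U x₀ = φ.app U x₁) :
    naivePre F ⟶ G where
  app U := TypeCat.ofHom (Quot.lift (φ.app U) (hφ U))
  naturality U V f := by
    ext ⟨x⟩
    exact NatTrans.naturality_apply φ f x

/-- A morphism to a sheaf exhibits it as `𝒮(F)` if it is locally surjective and, locally, two
sections of `F` have the same image exactly when they are chain homotopic. -/
lemma nonempty_naive_iso {F G : Psh k} (φ : F ⟶ G)
    (hφ : ∀ (U : (Sm k)ᵒᵖ) (x₀ x₁ : F.obj U), Homotopic F U x₀ x₁ → φ.app U x₀ = φ.app U x₁)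
    (hG : Presheaf.IsSheaf (nisnevich k) G)
    (hs : Presheaf.IsLocallySurjective (nisnevich k) (naivePreDesc φ hφ))
    (hi : Presheaf.IsLocallyInjective (nisnevich k) (naivePreDesc φ hφ)) :
    Nonempty (naive F ≅ G) := by
  have h := (nisnevich k).W_of_isLocallyBijective (naivePreDesc φ hφ)
  rw [GrothendieckTopology.W_iff] at h
  exact ⟨(sheafToPresheaf _ _).mapIso (asIso ((presheafToSheaf _ _).map (naivePreDesc φ hφ))) ≪≫
    (isoSheafify _ hG).symm⟩


/-- Sections of a rigid presheaf over `𝔸¹ × U` come from `U`: the section is homotopic, over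
`𝔸¹ × U`, to its composite with the zero section, by contracting the line. -/
lemma IsRigid.map_lineProj {G : Psh k} (hG : IsRigid G) {U : Sm k}
    (h : G.obj (op ((line k).obj U))) :
    G.map (lineProj U).op (G.map ((zeroSection k).app U).op h) = h := by
  have := hG _ _ _ ⟨G.map (lineMul U).op h, rfl, rfl⟩
  simp only [← Functor.map_comp_apply, ← op_comp] at this ⊢
  refine (congr(G.map ($(zeroSection_lineMul U)).op h)).symm.trans (this.trans ?_)
  refine (congr(G.map ($(oneSection_lineMul U)).op h)).trans ?_
  simp

/-- In a pullback square over a rigid presheaf `G`, a homotopy in `Z` that lifts to `F` at one of its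
ends lifts to `F`. -/
lemma exists_lift_homotopy {F Z T G : Psh k} {i : F ⟶ Z} {t : F ⟶ T} {r : Z ⟶ G}
    {e : T ⟶ G} (hG : IsRigid G) (H : IsPullback i t r e) {U : Sm k}
    (h : Z.obj (op ((line k).obj U))) {σ : U ⟶ (line k).obj U}
    (hσ : σ = (zeroSection k).app U ∨ σ = (oneSection k).app U)
    {a : F.obj (op U)} (ha : Z.map σ.op h = i.app _ a) :
    ∃ b : F.obj (op ((line k).obj U)), i.app _ b = h ∧ F.map σ.op b = a := by
  have H' := fun U ↦ (Types.isPullback_iff _ _ _ _).mp (H.app U)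
  have key {K : Psh k} (hK : IsRigid K) (x : K.obj (op ((line k).obj U))) :
      K.map (lineProj U).op (K.map σ.op x) = x := by
    obtain rfl | rfl := hσ
    · exact hK.map_lineProj x
    · refine Eq.trans ?_ (hK.map_lineProj x)
      exact congrArg (K.map (lineProj U).op) (hK _ _ _ ⟨x, rfl, rfl⟩).symm
  have hr : r.app _ h = e.app _ (T.map (lineProj U).op (t.app _ a)) := by
    rw [← key hG (r.app _ h), ← NatTrans.naturality_apply, ha, NatTrans.naturality_apply e]
    exact congrArg (G.map (lineProj U).op) (ConcreteCategory.congr_hom (H' _).1 a)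
  obtain ⟨b, hb, hb'⟩ := (H' _).2.2 _ _ hr
  refine ⟨b, hb, (H' _).2.1 _ _ ⟨?_, ?_⟩⟩
  · rw [NatTrans.naturality_apply, ← ha]
    exact congrArg (Z.map σ.op) hb
  · refine (NatTrans.naturality_apply t σ.op b).trans ?_
    refine (congrArg (T.map σ.op) hb').trans ?_
    rw [← Functor.map_comp_apply, ← op_comp]
    have : σ ≫ lineProj U = 𝟙 U := by
      obtain rfl | rfl := hσ
      · simp [zeroSection_app]
      · simp [oneSection_app]
    refine (congr(T.map ($this).op (t.app _ a))).trans ?_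
    simp

/-- The naive quotient, before sheafification, preserves fibre products over rigid presheaves. -/
lemma naivePreDesc_isPullback {F Z T G : Psh k} {i : F ⟶ Z} {t : F ⟶ T} {r : Z ⟶ G}
    {e : T ⟶ G} (hT : IsRigid T) (hG : IsRigid G) (H : IsPullback i t r e) :
    IsPullback (naivePreMap i) (naivePreDesc t fun _ _ _ h ↦ hT _ _ _ (h.natTrans t))
      (naivePreDesc r fun _ _ _ h ↦ hG _ _ _ (h.natTrans r)) e := by
  have H' := fun U ↦ (Types.isPullback_iff _ _ _ _).mp (H.app U)
  refine .of_forall_isPullback_app fun U ↦ (Types.isPullback_iff _ _ _ _).mpr ⟨?_, ?_, ?_⟩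
  · ext ⟨x⟩
    exact ConcreteCategory.congr_hom (H' U).1 x
  · rintro ⟨a⟩ ⟨b⟩ ⟨hab, hab'⟩
    -- Every chain of homotopies in `Z` starting at a section of `F` lifts to `F`.
    have chain (z w : Z.obj U) (hzw : Relation.EqvGen (Homotopic Z U) z w) :
        (∀ a, i.app U a = z → ∃ b, i.app U b = w ∧ Quot.mk (Homotopic F U) a = Quot.mk _ b) ∧
        (∀ a, i.app U a = w → ∃ b, i.app U b = z ∧ Quot.mk (Homotopic F U) a = Quot.mk _ b) := by
      induction hzw with
      | rel z w hzw =>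
        obtain ⟨h, hz, hw⟩ := hzw
        refine ⟨fun a ha ↦ ?_, fun a ha ↦ ?_⟩
        · obtain ⟨b, hb, hb'⟩ := exists_lift_homotopy hG H h (.inl rfl) (hz.trans ha.symm)
          refine ⟨F.map ((oneSection k).app U.unop).op b, ?_, Quot.sound ⟨b, hb', rfl⟩⟩
          exact (NatTrans.naturality_apply i _ b).trans
            ((congrArg (Z.map ((oneSection k).app U.unop).op) hb).trans hw)
        · obtain ⟨b, hb, hb'⟩ := exists_lift_homotopy hG H h (.inr rfl) (hw.trans ha.symm)
          refine ⟨F.map ((zeroSection k).app U.unop).op b, ?_, (Quot.sound ⟨b, rfl, hb'⟩).symm⟩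
          exact (NatTrans.naturality_apply i _ b).trans
            ((congrArg (Z.map ((zeroSection k).app U.unop).op) hb).trans hz)
      | refl z => exact ⟨fun a ha ↦ ⟨a, ha, rfl⟩, fun a ha ↦ ⟨a, ha, rfl⟩⟩
      | symm z w _ ih => exact ih.symm
      | trans z w v _ _ ih₁ ih₂ =>
        refine ⟨fun a ha ↦ ?_, fun a ha ↦ ?_⟩
        · obtain ⟨b, hb, hab⟩ := ih₁.1 a ha
          obtain ⟨c, hc, hbc⟩ := ih₂.1 b hb
          exact ⟨c, hc, hab.trans hbc⟩
        · obtain ⟨b, hb, hab⟩ := ih₂.2 a ha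
          obtain ⟨c, hc, hbc⟩ := ih₁.2 b hb
          exact ⟨c, hc, hab.trans hbc⟩
    obtain ⟨c, hc, hac⟩ := (chain _ _ (Quot.eqvGen_exact hab)).1 a rfl
    have hac' := congrArg
      ((naivePreDesc t fun _ _ _ h ↦ hT _ _ _ (h.natTrans t)).app U) hac
    exact hac.trans (congrArg _ ((H' U).2.1 _ _ ⟨hc, hac'.symm.trans hab'⟩))
  · rintro ⟨z⟩ y hzy
    obtain ⟨x, rfl, rfl⟩ := (H' U).2.2 z y hzy
    exact ⟨Quot.mk _ x, rfl, rfl⟩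

/-- Sheafifying the first map of a pullback square whose last map is between sheaves gives
a pullback square over the same map. -/
lemma _root_.CategoryTheory.IsPullback.exists_sheafifyMap {C : Type*} [Category* C]
    {J : GrothendieckTopology C} {A : Type*} [Category* A] [HasSheafify J A]
    {F Z T G : Cᵒᵖ ⥤ A} {i : F ⟶ Z} {t : F ⟶ T} {r : Z ⟶ G} {e : T ⟶ G}
    (hT : Presheaf.IsSheaf J T) (hG : Presheaf.IsSheaf J G) (H : IsPullback i t r e) :
    ∃ (t' : sheafify J F ⟶ T) (r' : sheafify J Z ⟶ G), IsPullback (sheafifyMap J i) t' r' e := by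
  have h := (H.map (presheafToSheaf J A)).map (sheafToPresheaf J A)
  refine ⟨sheafifyMap J t ≫ (isoSheafify J hT).inv, sheafifyMap J r ≫ (isoSheafify J hG).inv,
    h.of_iso (Iso.refl _) (Iso.refl _) (isoSheafify J hT).symm (isoSheafify J hG).symm
      ?_ ?_ ?_ ?_⟩
  · exact (Category.comp_id _).trans (Category.id_comp _).symm
  · exact (Category.id_comp _).symm
  · exact (Category.id_comp _).symm
  · change sheafifyMap J e ≫ (isoSheafify J hG).inv = (isoSheafify J hT).inv ≫ e
    rw [Iso.comp_inv_eq, Category.assoc, Iso.eq_inv_comp]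
    exact (toSheafify_naturality J e).symm

/-- The functor `𝒮` preserves fibre products over rigid sheaves. -/
lemma exists_isPullback_naiveMap {F Z T G : Psh k} {i : F ⟶ Z} {t : F ⟶ T} {r : Z ⟶ G}
    {e : T ⟶ G} (hT : IsRigid T) (hG : IsRigid G) (hT' : Presheaf.IsSheaf (nisnevich k) T)
    (hG' : Presheaf.IsSheaf (nisnevich k) G) (H : IsPullback i t r e) :
    ∃ (t' : naive F ⟶ T) (r' : naive Z ⟶ G), IsPullback (naiveMap i) t' r' e :=
  (naivePreDesc_isPullback hT hG H).exists_sheafifyMap hT' hG'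

lemma exists_isPullback_naiveIterMap {F Z T G : Psh k} {i : F ⟶ Z} {t : F ⟶ T} {r : Z ⟶ G}
    {e : T ⟶ G} (hT : IsRigid T) (hG : IsRigid G) (hT' : Presheaf.IsSheaf (nisnevich k) T)
    (hG' : Presheaf.IsSheaf (nisnevich k) G) (H : IsPullback i t r e) (n : ℕ) :
    ∃ (t' : naiveIter F n ⟶ T) (r' : naiveIter Z n ⟶ G),
      IsPullback (naiveIterMap i n) t' r' e := by
  induction n with
  | zero => exact ⟨t, r, H⟩
  | succ n ih =>
    obtain ⟨t', r', H'⟩ := ih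
    exact exists_isPullback_naiveMap hT hG hT' hG' H'

/-- Iterated naive `𝔸¹`-connected components of a fibre of a map to a rigid sheaf embed into
those of the source. -/
lemma Collapses.of_isPullback {F Z T G : Psh k} {i : F ⟶ Z} {t : F ⟶ T} {r : Z ⟶ G}
    {e : T ⟶ G} (hT : IsRigid T) (hG : IsRigid G) (hT' : Presheaf.IsSheaf (nisnevich k) T)
    (hG' : Presheaf.IsSheaf (nisnevich k) G) (he : Mono e) (H : IsPullback i t r e) {n : ℕ}
    (h : Collapses (naiveIter F n)) : Collapses (naiveIter Z n) := by
  obtain ⟨t', r', H'⟩ := exists_isPullback_naiveIterMap hT hG hT' hG' H n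
  have : Mono (naiveIterMap i n) := PullbackCone.mono_fst_of_is_pullback_of_mono H'.isLimit
  exact h.of_injective (naiveIterMap i n) (injective_of_mono _)

/-! ### Smooth schemes are reduced -/

lemma natDegree_eq_zero_of_isIntegral {R : Type*} [CommRing R] [IsDomain R]
    {p : Polynomial R} (hp : IsIntegral R p) : p.natDegree = 0 := by
  obtain ⟨f, hf, hfp⟩ := hp
  have h : (f.comp p).natDegree = 0 := by
    rw [Polynomial.comp, ← Polynomial.algebraMap_eq, hfp, Polynomial.natDegree_zero]
  rw [Polynomial.natDegree_comp, mul_eq_zero] at h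
  refine h.resolve_left fun h ↦ ?_
  rw [Polynomial.eq_one_of_monic_natDegree_zero hf h] at hfp
  simp at hfp

open TensorProduct in
/-- A smooth algebra `S` over a domain `R` is reduced: the formation of integral closures commutes
with smooth base change, and `R` is integrally closed in `R[X]`; if `s ∈ S` is nilpotent then
`s ⊗ X` is integral over `S`, so it is a constant of `S ⊗ R[X]`. -/
lemma isReduced_of_smooth (R S : Type u) [CommRing R] [IsDomain R] [CommRing S] [Algebra R S]
    [Algebra.Smooth R S] : _root_.IsReduced S := by
  refine ⟨fun s hs ↦ ?_⟩
  have hn : IsNilpotent (s ⊗ₜ[R] (Polynomial.X : Polynomial R)) := by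
    obtain ⟨m, hm⟩ := hs
    exact ⟨m, by rw [Algebra.TensorProduct.tmul_pow, hm, zero_tmul]⟩
  have hint : IsIntegral S (s ⊗ₜ[R] (Polynomial.X : Polynomial R)) := by
    obtain ⟨m, hm⟩ := hn
    refine ⟨Polynomial.X ^ m, Polynomial.monic_X_pow m, ?_⟩
    simp [hm]
  obtain ⟨w, hw⟩ := (TensorProduct.toIntegralClosure_bijective_of_smooth (R := R) (S := S)
    (B := Polynomial R)).2 ⟨_, hint⟩
  let φ : S ⊗[R] Polynomial R →ₗ[R] S :=
    (TensorProduct.rid R S).toLinearMap ∘ₗ (Polynomial.lcoeff R 1).lTensor S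
  have hφ (w : S ⊗[R] integralClosure R (Polynomial R)) :
      φ (TensorProduct.toIntegralClosure R S (Polynomial R) w).1 = 0 := by
    induction w with
    | zero => simp
    | add x y hx hy => simp only [map_add] at hx hy ⊢; simp [hx, hy]
    | tmul x y =>
      have : (y : Polynomial R).coeff 1 = 0 :=
        Polynomial.coeff_eq_zero_of_natDegree_lt (by
          rw [natDegree_eq_zero_of_isIntegral y.2]; exact one_pos)
      simp [φ, TensorProduct.toIntegralClosure, this]
  have := hφ w
  rw [hw] at this
  simpa [φ] using this

lemma Sm.isReduced (U : Sm k) : AlgebraicGeometry.IsReduced U.left := by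
  have := U.smooth
  refine @IsReduced.of_openCover _ U.left.affineCover fun i ↦ ?_
  let f : U.left.affineCover.X i ⟶ Spec (CommRingCat.of k) := U.left.affineCover.f i ≫ U.hom
  have hf : Smooth f := inferInstance
  have : IsAffine (U.left.affineCover.X i) := inferInstance
  have h : f.appTop.hom.Smooth := by
    exact (HasRingHomProperty.iff_of_isAffine (P := @Smooth)).mp hf
  algebraize [f.appTop.hom]
  have := isReduced_of_smooth Γ(Spec (CommRingCat.of k), ⊤) Γ(U.left.affineCover.X i, ⊤)
  exact isReduced_of_isAffine_isReduced _

/-! ### Functions on the affine line over a reduced scheme -/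

/-- Functions on a reduced scheme are determined by their values at points. -/
lemma section_ext_of_points {X : Scheme.{u}} [IsReduced X] {x y : Γ(X, ⊤)}
    (h : ∀ (K : Type u) [Field K] (p : Spec (CommRingCat.of K) ⟶ X), p.appTop x = p.appTop y) :
    x = y := by
  rw [← sub_eq_zero, ← basicOpen_eq_bot_iff, eq_bot_iff]
  intro u hu
  have hz : X.fromSpecResidueField u ⁻¹ᵁ X.basicOpen (x - y) = ⊥ := by
    rw [Scheme.preimage_basicOpen_top, map_sub, sub_eq_zero.mpr (h (X.residueField u) _),
      Scheme.basicOpen_zero]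
  let c : Spec (X.residueField u) := IsLocalRing.closedPoint (X.residueField u)
  have hm : c ∈ X.fromSpecResidueField u ⁻¹ᵁ X.basicOpen (x - y) := by
    change X.fromSpecResidueField u c ∈ X.basicOpen (x - y)
    rwa [Scheme.fromSpecResidueField_apply]
  rw [hz] at hm
  exact hm.elim

lemma Fn.ext_of_points {U : Sm k} {x y : Fn U}
    (h : ∀ (K : Type u) [Field K] (p : Spec (CommRingCat.of K) ⟶ U.left),
      p.appTop x = p.appTop y) : x = y :=
  have := U.isReduced
  section_ext_of_points h

open scoped AlgebraicGeometry in
/-- Invertible functions on the affine line over a field are constant. -/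
lemma appTop_homOfVector_eq_of_isUnit {K : Type u} [Field K]
    {g : Γ(𝔸(PUnit.{u + 1}; Spec (CommRingCat.of K)), ⊤)} (hg : IsUnit g)
    (a b : Γ(Spec (CommRingCat.of K), ⊤)) :
    (AffineSpace.homOfVector (n := PUnit.{u + 1}) (𝟙 _) fun _ ↦ a).appTop g =
      (AffineSpace.homOfVector (n := PUnit.{u + 1}) (𝟙 _) fun _ ↦ b).appTop g := by
  let R := CommRingCat.of K
  let e := AffineSpace.SpecIso PUnit.{u + 1} R
  let S := CommRingCat.of (MvPolynomial PUnit.{u + 1} K)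
  let g' : S := (Scheme.ΓSpecIso S).hom (e.inv.appTop g)
  have hg' : IsUnit g' := (hg.map e.inv.appTop.hom).map (Scheme.ΓSpecIso S).hom.hom
  obtain ⟨c, -, hc⟩ := MvPolynomial.isUnit_iff_eq_C_of_isReduced.mp hg'
  have hgc : g = (𝔸(PUnit.{u + 1}; Spec R) ↘ Spec R).appTop ((Scheme.ΓSpecIso R).inv c) := by
    have h₁ : g = e.hom.appTop (e.inv.appTop g) := by
      rw [← CommRingCat.comp_apply, ← Scheme.Hom.comp_appTop, e.hom_inv_id, Scheme.Hom.id_appTop]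
      rfl
    rw [h₁, AffineSpace.SpecIso_hom_appTop]
    change MvPolynomial.eval₂Hom _ _ g' = _
    rw [hc, MvPolynomial.coe_eval₂Hom, MvPolynomial.eval₂_C]
    rfl
  have key (d : Γ(Spec R, ⊤)) :
      (AffineSpace.homOfVector (n := PUnit.{u + 1}) (𝟙 _) fun _ ↦ d).appTop
        ((𝔸(PUnit.{u + 1}; Spec R) ↘ Spec R).appTop ((Scheme.ΓSpecIso R).inv c)) =
      (Scheme.ΓSpecIso R).inv c := by
    rw [← CommRingCat.comp_apply (Scheme.Hom.appTop _), ← Scheme.Hom.comp_appTop,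
      AffineSpace.homOfVector_over, Scheme.Hom.id_appTop]
    rfl
  rw [hgc]
  exact (key a).trans (key b).symm

lemma appTop_pull_lineLift {U : Sm k} {K : Type u} [Field K]
    (p : Spec (CommRingCat.of K) ⟶ U.left) (a : Fn U) (f : Fn ((line k).obj U)) :
    p.appTop (pull (lineLift (𝟙 U) a) f) =
      (AffineSpace.homOfVector (n := PUnit.{u + 1}) (𝟙 _) fun _ ↦ p.appTop a).appTop
        ((AffineSpace.map PUnit.{u + 1} p).appTop f) := by
  have : p ≫ AffineSpace.homOfVector (n := PUnit.{u + 1}) (𝟙 U.left) (fun _ ↦ a) =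
      AffineSpace.homOfVector (𝟙 _) (fun _ ↦ p.appTop a) ≫ AffineSpace.map PUnit.{u + 1} p := by
    refine AffineSpace.hom_ext ?_ fun i ↦ ?_
    · simp
    · rw [Scheme.Hom.comp_appTop, Scheme.Hom.comp_appTop, CommRingCat.comp_apply,
        CommRingCat.comp_apply, AffineSpace.map_appTop_coord, AffineSpace.homOfVector_appTop_coord,
        AffineSpace.homOfVector_appTop_coord]
  have := congr(($this).appTop f)
  rwa [Scheme.Hom.comp_appTop, Scheme.Hom.comp_appTop] at this

lemma pull_zero_eq_pull_one_of_isUnit {U : Sm k} {f : Fn ((line k).obj U)} (hf : IsUnit f) :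
    pull (lineLift (𝟙 U) 0) f = pull (lineLift (𝟙 U) 1) f := by
  refine Fn.ext_of_points fun K _ p ↦ ?_
  rw [appTop_pull_lineLift, appTop_pull_lineLift]
  exact appTop_homOfVector_eq_of_isUnit (hf.map (AffineSpace.map PUnit.{u + 1} p).appTop.hom) _ _

lemma isUnit_or_isUnit_sub_one {A B : Type*} [CommRing A] [CommRing B] [IsDomain B] (q : A →+* B)
    {f x y : A} (h : (f * y - 1) * ((f - 1) * x - 1) = 0) :
    IsUnit (q f) ∨ IsUnit (q (f - 1)) := by
  have h' := congrArg q h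
  simp only [map_mul, map_sub, map_one, map_zero, mul_eq_zero, sub_eq_zero] at h'
  rw [map_sub, map_one]
  exact h'.imp (.of_mul_eq_one _) (.of_mul_eq_one _)

/-- A function `f` on `𝔸¹ × U` for which `(f y - 1) ((f - 1) x - 1) = 0` has a solution restricts
to a constant on each line over a point of `U`, since `f` or `f - 1` is invertible there. -/
lemma pull_zero_eq_pull_one_of_mul_eq_zero {U : Sm k} {f x y : Fn ((line k).obj U)}
    (h : (f * y - 1) * ((f - 1) * x - 1) = 0) :
    pull (lineLift (𝟙 U) 0) f = pull (lineLift (𝟙 U) 1) f := by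
  refine Fn.ext_of_points fun K _ p ↦ ?_
  obtain h' | h' := isUnit_or_isUnit_sub_one (AffineSpace.map PUnit.{u + 1} p).appTop.hom h
  · rw [appTop_pull_lineLift, appTop_pull_lineLift]
    exact appTop_homOfVector_eq_of_isUnit h' _ _
  · suffices p.appTop (pull (lineLift (𝟙 U) 0) (f - 1)) =
        p.appTop (pull (lineLift (𝟙 U) 1) (f - 1)) by
      simpa only [map_sub, map_one, sub_left_inj] using this
    rw [appTop_pull_lineLift, appTop_pull_lineLift]
    exact appTop_homOfVector_eq_of_isUnit h' _ _

/-! ### Nisnevich descent for regular functions -/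

/-- The presheaf `X ↦ Γ(X, ⊤)` of sets on schemes. -/
def globalSections : Scheme.{u}ᵒᵖ ⥤ Type u where
  obj X := Γ(X.unop, ⊤)
  map f := TypeCat.ofHom fun x ↦ f.unop.appTop x
  map_id X := by
    ext x
    exact congr($(Scheme.Hom.id_appTop (X := X.unop)).hom x)
  map_comp f g := by
    ext x
    exact congr($(Scheme.Hom.comp_appTop g.unop f.unop).hom x)

instance : (globalSections.{u}).IsRepresentable where
  has_representation := by
    refine ⟨_, ⟨{ 
      homEquiv := (AffineSpace.toSpecMvPolyIntEquiv PUnit.{u + 1}).trans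
        (Equiv.funUnique PUnit.{u + 1} _)
      homEquiv_comp := fun f g ↦ rfl }⟩⟩

lemma isSheafFor_globalSections {X : Scheme.{u}} {ι : Type*} {U : ι → Scheme.{u}}
    (f : ∀ i, U i ⟶ X) (hf : ∀ i, Etale (f i)) (hf' : ∀ x, ∃ i, x ∈ Set.range (f i)) :
    Presieve.IsSheafFor globalSections (.ofArrows U f) := by
  rw [Presieve.isSheafFor_iff_generate]
  refine GrothendieckTopology.Subcanonical.isSheaf_of_isRepresentable
    (J := Scheme.fppfTopology) _ _ (Precoverage.generate_mem_toGrothendieck ?_)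
  refine Scheme.ofArrows_mem_precoverage_iff _ |>.mpr ⟨hf', fun i ↦ ?_⟩
  have := hf i
  exact ⟨inferInstance, inferInstance⟩

/-- The étale members of a sieve. For a Nisnevich covering sieve they form an fppf covering of the
underlying scheme. -/
def EtaleMember {X : Sm k} (S : Sieve X) : Type (u + 1) :=
  { p : Over X // S p.hom ∧ Etale p.hom.left }

lemma EtaleMember.isSheafFor {X : Sm k} {S : Sieve X} (hS : S ∈ nisnevich k X) :
    Presieve.IsSheafFor globalSections
      (.ofArrows (fun i : EtaleMember S ↦ i.1.left.left) (fun i ↦ i.1.hom.left)) := by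
  refine isSheafFor_globalSections _ (fun i ↦ i.2.2) fun x ↦ ?_
  obtain ⟨U, f, hf, he, u, hu, -⟩ := hS x
  exact ⟨⟨Over.mk f, hf, he⟩, u, hu⟩

lemma Fn.ext_of_mem_nisnevich {X : Sm k} {S : Sieve X} (hS : S ∈ nisnevich k X) {x y : Fn X}
    (h : ∀ (U : Sm k) (f : U ⟶ X), S f → pull f x = pull f y) : x = y := by
  refine (EtaleMember.isSheafFor hS).isSeparatedFor.ext ?_
  rintro _ _ ⟨i⟩
  exact h _ _ i.2.1

/-- The sieve generated by the étale members of a sieve. -/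
def etaleSieve {X : Sm k} (S : Sieve X) : Sieve X :=
  .generate fun _ f ↦ S f ∧ Etale f.left

lemma etaleSieve_mem {X : Sm k} {S : Sieve X} (hS : S ∈ nisnevich k X) :
    etaleSieve S ∈ nisnevich k X := by
  intro x
  obtain ⟨U, f, hf, h⟩ := hS x
  exact ⟨U, f, Sieve.le_generate _ _ _ ⟨hf, h.1⟩, h⟩

/-- Fibre products along étale morphisms exist in `Sm k` and agree with those of schemes. -/
lemma exists_pullback {X U V : Sm k} (f : U ⟶ X) (g : V ⟶ X) (hf : Etale f.left) :
    ∃ (W : Sm k) (p : W ⟶ U) (q : W ⟶ V), IsPullback p.left q.left f.left g.left := by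
  have := V.smooth
  have := V.quasiCompact
  have := U.smooth
  have := U.quasiCompact
  have : IsLocallyNoetherian U.left :=
    LocallyOfFiniteType.isLocallyNoetherian (Y := Spec (CommRingCat.of k)) U.hom
  have : CompactSpace U.left :=
    QuasiCompact.compactSpace_of_compactSpace (Y := Spec (CommRingCat.of k)) U.hom
  have : IsNoetherian U.left := {}
  have : QuasiCompact f.left := inferInstance
  refine ⟨Sm.mk (pullback.snd f.left g.left ≫ V.hom) inferInstance inferInstance,
    MorphismProperty.Over.homMk (pullback.fst f.left g.left) ?_ trivial,
    MorphismProperty.Over.homMk (pullback.snd f.left g.left) rfl trivial,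
    IsPullback.of_hasPullback f.left g.left⟩
  change pullback.fst f.left g.left ≫ U.hom = pullback.snd f.left g.left ≫ V.hom
  rw [← MorphismProperty.Over.w f, ← MorphismProperty.Over.w g, pullback.condition_assoc]

/-- Regular functions glue along Nisnevich covering sieves. The function is glued from the étale
members, whose fibre products are smooth again, and it restricts correctly to any other member `f`
because the étale members, pulled back along `f`, cover the source of `f`. -/
lemma Fn.exists_glue {X : Sm k} {S : Sieve X} (hS : S ∈ nisnevich k X)
    (s : ∀ ⦃U : Sm k⦄ (f : U ⟶ X), S f → Fn U)
    (hs : ∀ ⦃U V : Sm k⦄ (f : U ⟶ X) (hf : S f) (g : V ⟶ U),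
      pull g (s f hf) = s (g ≫ f) (S.downward_closed hf g)) :
    ∃ t : Fn X, ∀ ⦃U : Sm k⦄ (f : U ⟶ X) (hf : S f), pull f t = s f hf := by
  have h := (Presieve.isSheafFor_arrows_iff _ _).mp (EtaleMember.isSheafFor hS)
  obtain ⟨t, ht, -⟩ := h (fun i ↦ s i.1.hom i.2.1) <| by
    intro i j Z gi gj hg
    obtain ⟨W, p, q, hW⟩ := exists_pullback i.1.hom j.1.hom i.2.2
    have hpq : p ≫ i.1.hom = q ≫ j.1.hom := by
      ext : 1
      exact hW.w
    have hl : pull p (s i.1.hom i.2.1) = pull q (s j.1.hom j.2.1) := by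
      rw [hs, hs]
      congr!
    let l := hW.lift gi gj hg
    have h₁ : globalSections.map gi.op (s i.1.hom i.2.1) =
        globalSections.map l.op (pull p (s i.1.hom i.2.1)) := by
      rw [← hW.lift_fst gi gj hg]
      exact Functor.map_comp_apply globalSections p.left.op l.op _
    have h₂ : globalSections.map gj.op (s j.1.hom j.2.1) =
        globalSections.map l.op (pull q (s j.1.hom j.2.1)) := by
      conv_lhs => rw [← hW.lift_snd gi gj hg]
      exact Functor.map_comp_apply globalSections q.left.op l.op _
    rw [h₁, h₂, hl]
  refine ⟨t, fun U f hf ↦ ?_⟩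
  refine Fn.ext_of_mem_nisnevich ((nisnevich k).pullback_stable f (etaleSieve_mem hS)) ?_
  rintro V g ⟨W, a, e, he, hae⟩
  rw [hs]
  refine (pull_pull f g t).trans ?_
  have : pull e t = s e he.1 := ht ⟨Over.mk e, he⟩
  have h' : pull (a ≫ e) t = s (a ≫ e) (S.downward_closed he.1 a) := by
    rw [← hs e he.1 a, ← this]
    exact (pull_pull e a t).symm
  have key (φ : V ⟶ X) (hφ : a ≫ e = φ) (hφ' : S φ) : pull φ t = s φ hφ' := by
    subst hφ
    exact h'
  exact key _ hae _

/-! ### Sheaves of solutions of polynomial equations -/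

variable {σ ι : Type}

lemma map_aeval_int {A B : Type*} [CommRing A] [CommRing B] (φ : A →+* B) (v : σ → A)
    (p : MvPolynomial σ ℤ) :
    φ (MvPolynomial.aeval v p) = MvPolynomial.aeval (fun j ↦ φ (v j)) p :=
  (MvPolynomial.comp_aeval_apply (f := v) φ.toIntAlgHom p)

/-- The solutions in a commutative ring `A` of a system of polynomial equations with integer
coefficients. -/
@[ext]
structure Solution (P : ι → MvPolynomial σ ℤ) (A : Type u) [CommRing A] where
  /-- The components of a solution. -/
  val : σ → A
  aeval_val : ∀ i, MvPolynomial.aeval val (P i) = 0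

/-- The image of a solution under a ring homomorphism. -/
def Solution.map {P : ι → MvPolynomial σ ℤ} {A B : Type u} [CommRing A] [CommRing B] (φ : A →+* B)
    (v : Solution P A) : Solution P B where
  val j := φ (v.val j)
  aeval_val i := by rw [← map_aeval_int, v.aeval_val, map_zero]

variable (k) in
/-- The presheaf of solutions, in the rings of regular functions, of a system of polynomial
equations with integer coefficients. It is represented by an affine scheme over `k`, in general not
a smooth one. -/
def zeros (P : ι → MvPolynomial σ ℤ) : Psh k where
  obj U := ULift.{u + 1} (Solution P (Fn U.unop))
  map {U V} f := TypeCat.ofHom fun v ↦ ⟨v.down.map (pull f.unop)⟩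
  map_id U := by
    ext v j
    exact congr($(pull_id U.unop) (ULift.down v |>.val j))
  map_comp f g := by
    ext v j
    exact (pull_pull f.unop g.unop (ULift.down v |>.val j)).symm

/-- The `j`-th component of a section of `zeros k P`. -/
def zeros.val {P : ι → MvPolynomial σ ℤ} {U : (Sm k)ᵒᵖ} (v : (zeros k P).obj U) (j : σ) :
    Fn U.unop :=
  (show ULift.{u + 1} (Solution P (Fn U.unop)) from v).down.val j

lemma zeros.aeval_val {P : ι → MvPolynomial σ ℤ} {U : (Sm k)ᵒᵖ} (v : (zeros k P).obj U) (i : ι) :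
    MvPolynomial.aeval (zeros.val v) (P i) = 0 :=
  (show ULift.{u + 1} (Solution P (Fn U.unop)) from v).down.aeval_val i

/-- The section of `zeros k P` given by a solution. -/
def zeros.mk {P : ι → MvPolynomial σ ℤ} {U : Sm k} (v : σ → Fn U)
    (hv : ∀ i, MvPolynomial.aeval v (P i) = 0) : (zeros k P).obj (op U) :=
  ULift.up.{u + 1} (Solution.mk v hv)

@[simp]
lemma zeros.val_mk {P : ι → MvPolynomial σ ℤ} {U : Sm k} (v : σ → Fn U)
    (hv : ∀ i, MvPolynomial.aeval v (P i) = 0) : zeros.val (zeros.mk v hv) = v := rfl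

lemma zeros.ext {P : ι → MvPolynomial σ ℤ} {U : (Sm k)ᵒᵖ} {v w : (zeros k P).obj U}
    (h : ∀ j, zeros.val v j = zeros.val w j) : v = w :=
  ULift.ext (α := Solution P (Fn U.unop)) _ _ (Solution.ext (funext h))

lemma zeros.homotopic {P : ι → MvPolynomial σ ℤ} {U : Sm k} {v w : (zeros k P).obj (op U)}
    (h : (zeros k P).obj (op ((line k).obj U)))
    (h₀ : ∀ j, pull (lineLift (𝟙 U) 0) (zeros.val h j) = zeros.val v j)
    (h₁ : ∀ j, pull (lineLift (𝟙 U) 1) (zeros.val h j) = zeros.val w j) : Homotopic (zeros k P) (op U) v w :=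
  ⟨h, zeros.ext h₀, zeros.ext h₁⟩

lemma zeros.isSheaf (P : ι → MvPolynomial σ ℤ) :
    Presheaf.IsSheaf (nisnevich k) (zeros k P) := by
  rw [isSheaf_iff_isSheaf_of_type]
  intro X S hS x hx
  have hx' := (Presieve.compatible_iff_sieveCompatible x).mp hx
  have hglue (j : σ) := Fn.exists_glue hS (fun U f hf ↦ zeros.val (x f hf) j) fun U V f hf g ↦
    (congrArg (fun y ↦ zeros.val y j) (hx' f g hf)).symm
  choose t ht using hglue
  refine ⟨zeros.mk t fun i ↦ ?_, fun U f hf ↦ zeros.ext fun j ↦ ht j f hf, fun y hy ↦ ?_⟩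
  · refine Fn.ext_of_mem_nisnevich hS fun U f hf ↦ ?_
    rw [map_aeval_int, map_zero]
    simp only [ht _ f hf]
    exact zeros.aeval_val (x f hf) i
  · refine zeros.ext fun j ↦ Fn.ext_of_mem_nisnevich hS fun U f hf ↦ ?_
    exact (congrArg (fun y ↦ zeros.val y j) (hy f hf)).trans (ht j f hf).symm

/-- The equations `t y = 1` expressing that `t` is an `ι`-tuple of invertible functions. -/
def unitEq (ι : Type) (i : ι) : MvPolynomial (ι ⊕ ι) ℤ :=
  MvPolynomial.X (.inl i) * MvPolynomial.X (.inr i) - 1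

lemma isRigid_unitEq : IsRigid (zeros k (unitEq ι)) := by
  rintro U _ _ ⟨h, rfl, rfl⟩
  have hu (i : ι) : zeros.val h (.inl i) * zeros.val h (.inr i) = 1 := by
    simpa [unitEq, sub_eq_zero] using zeros.aeval_val h i
  refine zeros.ext fun j ↦ ?_
  refine pull_zero_eq_pull_one_of_isUnit (U := U.unop) ?_
  cases j with
  | inl i => exact .of_mul_eq_one _ (hu i)
  | inr i => exact .of_mul_eq_one_right _ (hu i)

/-- The empty system in no variables, whose sheaf of solutions is the point. -/
abbrev emptyEq (i : Empty) : MvPolynomial Empty ℤ := i.elim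

lemma isRigid_emptyEq : IsRigid (zeros k emptyEq) :=
  fun _ _ _ _ ↦ zeros.ext fun j ↦ j.elim

/-- The equation-free system in one variable, whose sheaf of solutions is the affine line. -/
abbrev freeEq (i : Empty) : MvPolynomial Unit ℤ := i.elim

lemma collapses_freeEq : Collapses (zeros k freeEq) := by
  intro h
  have := @h (zeros.mk (fun _ ↦ 0) fun i ↦ i.elim) (zeros.mk (fun _ ↦ 1) fun i ↦ i.elim)
    (toNaive_eq_of_homotopic (zeros.homotopic (zeros.mk (fun _ ↦ lineCoord _) fun i ↦ i.elim)
      (fun j ↦ by simp) (fun j ↦ by simp)))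
  have h01 : (0 : Fn (Sm.point k)) = 1 := congrArg (fun v ↦ zeros.val v ()) this
  have : Nontrivial (Fn (Sm.point k)) :=
    inferInstanceAs (Nontrivial Γ(Spec (CommRingCat.of k), ⊤))
  exact zero_ne_one h01

/-! ### Zariski covers -/

lemma Sm.isNoetherian (U : Sm k) : IsNoetherian U.left := by
  have := U.smooth
  have := U.quasiCompact
  have : IsLocallyNoetherian U.left :=
    LocallyOfFiniteType.isLocallyNoetherian (Y := Spec (CommRingCat.of k)) U.hom
  have : CompactSpace U.left :=
    QuasiCompact.compactSpace_of_compactSpace (Y := Spec (CommRingCat.of k)) U.hom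
  exact {}

/-- An open subscheme of a smooth scheme of finite type. -/
def Sm.opens (U : Sm k) (D : U.left.Opens) : Sm k :=
  have := U.smooth
  have := U.quasiCompact
  have := U.isNoetherian
  Sm.mk (D.ι ≫ U.hom) inferInstance inferInstance

/-- The inclusion of an open subscheme. -/
def Sm.opensι (U : Sm k) (D : U.left.Opens) : U.opens D ⟶ U :=
  MorphismProperty.Over.homMk D.ι rfl trivial

lemma isNisnevichAt_of_isOpenImmersion {X Y : Scheme.{u}} (f : Y ⟶ X) [IsOpenImmersion f] (y : Y) :
    IsNisnevichAt f (f y) :=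
  ⟨inferInstance, y, rfl, inferInstance⟩

lemma mem_nisnevich_of_opens {U : Sm k} {S : Sieve U}
    (h : ∀ x : U.left, ∃ D : U.left.Opens, x ∈ D ∧ S (U.opensι D)) : S ∈ nisnevich k U := by
  intro x
  obtain ⟨D, hx, hD⟩ := h x
  exact ⟨_, _, hD, isNisnevichAt_of_isOpenImmersion D.ι ⟨x, hx⟩⟩

lemma isUnit_appTop_of_le_basicOpen {X : Scheme.{u}} {D : X.Opens} {f : Γ(X, ⊤)}
    (h : D ≤ X.basicOpen f) : IsUnit (D.ι.appTop f) := by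
  refine RingedSpace.isUnit_of_isUnit_germ D.toScheme.toRingedSpace ⊤ _ fun x hx ↦ ?_
  rw [← RingedSpace.mem_basicOpen]
  have : x ∈ D.ι ⁻¹ᵁ X.basicOpen f := h x.2
  rwa [Scheme.preimage_basicOpen_top] at this

lemma isUnit_pull_opensι {U : Sm k} {D : U.left.Opens} {f : Fn U}
    (h : D ≤ U.left.basicOpen f) : IsUnit (pull (U.opensι D) f) :=
  isUnit_appTop_of_le_basicOpen h

lemma mem_basicOpen_or_mem_basicOpen_sub_one {X : Scheme.{u}} (f : Γ(X, ⊤)) (x : X) :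
    x ∈ X.basicOpen f ∨ x ∈ X.basicOpen (f - 1) := by
  rw [Scheme.mem_basicOpen (U := ⊤) X f x trivial, Scheme.mem_basicOpen (U := ⊤) X (f - 1) x trivial,
    map_sub, map_one]
  refine (IsLocalRing.isUnit_or_isUnit_one_sub_self _).imp_right fun h ↦ ?_
  rw [← IsUnit.neg_iff, neg_sub]
  exact h

/-- Locally, each of finitely many functions `f` has `f` or `f - 1` invertible. -/
lemma exists_opens_isUnit {σ : Type} [Finite σ] {U : Sm k} (f : σ → Fn U) (x : U.left) :
    ∃ D : U.left.Opens, x ∈ D ∧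
      ∀ j, IsUnit (pull (U.opensι D) (f j)) ∨ IsUnit (pull (U.opensι D) (f j) - 1) := by
  choose g hg hx using fun j ↦ show ∃ g : Fn U, (g = f j ∨ g = f j - 1) ∧
      x ∈ U.left.basicOpen g by
    obtain h | h := mem_basicOpen_or_mem_basicOpen_sub_one (f j) x
    · exact ⟨_, .inl rfl, h⟩
    · exact ⟨_, .inr rfl, h⟩
  have hopen : IsOpen (⋂ j, (U.left.basicOpen (g j) : Set U.left)) :=
    isOpen_iInter_of_finite fun j ↦ (U.left.basicOpen (g j)).isOpen
  refine ⟨⟨_, hopen⟩, Set.mem_iInter.mpr hx, fun j ↦ ?_⟩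
  have hu : IsUnit (pull (U.opensι ⟨_, hopen⟩) (g j)) :=
    isUnit_pull_opensι fun y hy ↦ Set.mem_iInter.mp hy j
  obtain h | h := hg j
  · exact .inl (h ▸ hu)
  · right
    rwa [h, map_sub, map_one] at hu

/-! ### Breaking affine lines -/

open MvPolynomial in
/-- The system obtained from `P` by adding, for each variable `t` of `P`, two new variables `x, y`
and the equation `(t y - 1) ((t - 1) x - 1) = 0`. Every solution of the new system on `𝔸¹ × U` has
`t` constant along the lines, while over the open sets `t ≠ 0` and `t ≠ 1` the new variables
can be chosen, uniquely up to homotopy. -/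
def breakup (P : ι → MvPolynomial σ ℤ) : ι ⊕ σ → MvPolynomial (σ ⊕ (σ ⊕ σ)) ℤ
  | .inl i => rename .inl (P i)
  | .inr j => (X (.inl j) * X (.inr (.inr j)) - 1) * ((X (.inl j) - 1) * X (.inr (.inl j)) - 1)

lemma aeval_breakup_inl {A : Type*} [CommRing A] (P : ι → MvPolynomial σ ℤ)
    (v : σ ⊕ (σ ⊕ σ) → A) (i : ι) :
    MvPolynomial.aeval v (breakup P (.inl i)) = MvPolynomial.aeval (fun j ↦ v (.inl j)) (P i) :=
  MvPolynomial.aeval_rename _ _ _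

lemma aeval_breakup_inr {A : Type*} [CommRing A] (P : ι → MvPolynomial σ ℤ)
    (v : σ ⊕ (σ ⊕ σ) → A) (j : σ) :
    MvPolynomial.aeval v (breakup P (.inr j)) =
      (v (.inl j) * v (.inr (.inr j)) - 1) * ((v (.inl j) - 1) * v (.inr (.inl j)) - 1) := by
  simp [breakup]

lemma aeval_breakup_eq_zero {A : Type*} [CommRing A] {P : ι → MvPolynomial σ ℤ}
    {f x y : σ → A} (hf : ∀ i, MvPolynomial.aeval f (P i) = 0)
    (h : ∀ j, (f j * y j - 1) * ((f j - 1) * x j - 1) = 0) (i : ι ⊕ σ) :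
    MvPolynomial.aeval (Sum.elim f (Sum.elim x y)) (breakup P i) = 0 := by
  cases i with
  | inl i => exact (aeval_breakup_inl _ _ _).trans (hf i)
  | inr j => exact (aeval_breakup_inr _ _ _).trans (h j)

variable (k) in
/-- The projection to the original variables. -/
def breakupProj (P : ι → MvPolynomial σ ℤ) : zeros k (breakup P) ⟶ zeros k P where
  app U := TypeCat.ofHom fun v ↦ zeros.mk (U := U.unop) (fun j ↦ zeros.val v (.inl j)) fun i ↦ by
    rw [← aeval_breakup_inl P (zeros.val v) i]
    exact zeros.aeval_val v _
  naturality U V f := rfl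

lemma breakupProj_eq_of_homotopic {P : ι → MvPolynomial σ ℤ} (U : (Sm k)ᵒᵖ)
    (v w : (zeros k (breakup P)).obj U) (h : Homotopic _ U v w) :
    (breakupProj k P).app U v = (breakupProj k P).app U w := by
  obtain ⟨h, rfl, rfl⟩ := h
  refine zeros.ext fun j ↦ ?_
  refine pull_zero_eq_pull_one_of_mul_eq_zero (U := U.unop)
    (x := zeros.val h (.inr (.inl j))) (y := zeros.val h (.inr (.inr j))) ?_
  exact (aeval_breakup_inr P (zeros.val h) j).symm.trans (zeros.aeval_val h _)

/-- Each hypothesis on `(x, y)` and `(x', y')` makes the equation hold along the segment joining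
them. -/
lemma interpolate {A B : Type*} [CommRing A] [CommRing B] (p : A →+* B) (s : B)
    {f x y x' y' : A} (h₀ : (f * y - 1) * ((f - 1) * x - 1) = 0)
    (h : (f * y = 1 ∧ f * y' = 1) ∨ ((f - 1) * x = 1 ∧ (f - 1) * x' = 1) ∨
      (x = x' ∧ f * y' = 1) ∨ (y = y' ∧ (f - 1) * x' = 1)) :
    (p f * (p y + s * (p y' - p y)) - 1) *
      ((p f - 1) * (p x + s * (p x' - p x)) - 1) = 0 := by
  have h₁ := congrArg p h₀
  simp only [map_mul, map_sub, map_one, map_zero] at h₁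
  obtain ⟨h, h'⟩ | ⟨h, h'⟩ | ⟨rfl, h'⟩ | ⟨rfl, h'⟩ := h
  · have h := congrArg p h
    have h' := congrArg p h'
    simp only [map_mul, map_one] at h h'
    linear_combination ((p f - 1) * (p x + s * (p x' - p x)) - 1) * ((1 - s) * h + s * h')
  · have h := congrArg p h
    have h' := congrArg p h'
    simp only [map_mul, map_sub, map_one] at h h'
    linear_combination (p f * (p y + s * (p y' - p y)) - 1) * ((1 - s) * h + s * h')
  · have h' := congrArg p h'
    simp only [map_mul, map_one] at h'
    linear_combination (1 - s) * h₁ + s * ((p f - 1) * p x - 1) * h'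
  · have h' := congrArg p h'
    simp only [map_mul, map_sub, map_one] at h'
    linear_combination (1 - s) * h₁ + s * (p f * p y - 1) * h'

/-- The linear homotopy between two solutions with the same image under `breakupProj`. -/
lemma homotopic_breakup {P : ι → MvPolynomial σ ℤ} {U : Sm k} {f x y x' y' : σ → Fn U}
    (hv : ∀ i, MvPolynomial.aeval (Sum.elim f (Sum.elim x y)) (breakup P i) = 0)
    (hw : ∀ i, MvPolynomial.aeval (Sum.elim f (Sum.elim x' y')) (breakup P i) = 0)
    (h : ∀ j, (f j * y j = 1 ∧ f j * y' j = 1) ∨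
      ((f j - 1) * x j = 1 ∧ (f j - 1) * x' j = 1) ∨
      (x j = x' j ∧ f j * y' j = 1) ∨ (y j = y' j ∧ (f j - 1) * x' j = 1)) :
    Homotopic (zeros k (breakup P)) (op U) (zeros.mk _ hv) (zeros.mk _ hw) := by
  let p := pull (lineProj U)
  let s := lineCoord U
  refine zeros.homotopic (zeros.mk (Sum.elim (fun j ↦ p (f j)) (Sum.elim
    (fun j ↦ p (x j) + s * (p (x' j) - p (x j))) (fun j ↦ p (y j) + s * (p (y' j) - p (y j)))))
      (aeval_breakup_eq_zero (fun i ↦ ?_) fun j ↦ ?_)) ?_ ?_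
  · rw [← map_aeval_int]
    exact (congrArg p ((aeval_breakup_inl P _ i).symm.trans (hv (.inl i)))).trans (map_zero p)
  · have h₀ : (f j * y j - 1) * ((f j - 1) * x j - 1) = 0 :=
      (aeval_breakup_inr P _ j).symm.trans (hv (.inr j))
    exact interpolate p s h₀ (h j)
  · rintro (j | j | j) <;> simp [p, s, pull_pull, pull_id]
  · rintro (j | j | j) <;> simp [p, s, pull_pull, pull_id]

/-- Where each `f j` or `f j - 1` is invertible, `f` lifts along `breakupProj`, and any two lifts
are chain homotopic. -/
lemma exists_lift_breakup {P : ι → MvPolynomial σ ℤ} {U : Sm k} (v : (zeros k P).obj (op U))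
    (hv : ∀ j, IsUnit (zeros.val v j) ∨ IsUnit (zeros.val v j - 1)) :
    ∃ w : (zeros k (breakup P)).obj (op U), (breakupProj k P).app _ w = v ∧
      ∀ w' : (zeros k (breakup P)).obj (op U), (breakupProj k P).app _ w' = v →
        Quot.mk (Homotopic _ _) w' = Quot.mk _ w := by
  classical
  let f : σ → Fn U := zeros.val v
  have hf (i : ι) : MvPolynomial.aeval f (P i) = 0 := zeros.aeval_val v i
  have (j : σ) : ∃ (c : Bool) (g : Fn U), (if c then f j else f j - 1) * g = 1 := by
    obtain h | h := hv j
    · exact ⟨true, h.exists_right_inv⟩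
    · exact ⟨false, h.exists_right_inv⟩
  choose c g hg using this
  have hw := aeval_breakup_eq_zero hf
    (x := fun j ↦ if c j then 0 else g j) (y := fun j ↦ if c j then g j else 0) fun j ↦ by
      cases h : c j
      · simp [show (f j - 1) * g j = 1 by simpa [h] using hg j]
      · simp [show f j * g j = 1 by simpa [h] using hg j]
  refine ⟨zeros.mk _ hw, rfl, fun w' hw' ↦ ?_⟩
  have hw'f (j : σ) : zeros.val w' (.inl j) = f j := congrArg (fun v ↦ zeros.val v j) hw'
  let x (j : σ) : Fn U := zeros.val w' (.inr (.inl j))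
  let y (j : σ) : Fn U := zeros.val w' (.inr (.inr j))
  have hxy (j : σ) : (f j * y j - 1) * ((f j - 1) * x j - 1) = 0 := by
    rw [← hw'f]
    exact (aeval_breakup_inr P (zeros.val w') j).symm.trans (zeros.aeval_val w' _)
  have hw'' : w' = zeros.mk _ (aeval_breakup_eq_zero hf hxy) := by
    refine zeros.ext ?_
    rintro (j | j | j)
    · exact hw'f j
    · rfl
    · rfl
  rw [hw'']
  -- First move the variable whose coefficient is invertible to the solution of its equation,
  -- then the other variable to `0`.
  have hm := aeval_breakup_eq_zero hf
    (x := fun j ↦ if c j then x j else g j) (y := fun j ↦ if c j then g j else y j) fun j ↦ by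
      cases h : c j
      · simp [show (f j - 1) * g j = 1 by simpa [h] using hg j]
      · simp [show f j * g j = 1 by simpa [h] using hg j]
  refine (Quot.sound (homotopic_breakup _ hm fun j ↦ ?_)).trans
    (Quot.sound (homotopic_breakup hm hw fun j ↦ ?_))
  · cases h : c j
    · exact .inr (.inr (.inr ⟨by simp, by simpa [h] using hg j⟩))
    · exact .inr (.inr (.inl ⟨by simp, by simpa [h] using hg j⟩))
  · cases h : c j
    · exact .inr (.inl ⟨by simpa [h] using hg j, by simpa [h] using hg j⟩)
    · exact .inl ⟨by simpa [h] using hg j, by simpa [h] using hg j⟩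

lemma nonempty_naive_breakup_iso [Finite σ] (P : ι → MvPolynomial σ ℤ) :
    Nonempty (naive (zeros k (breakup P)) ≅ zeros k P) := by
  refine nonempty_naive_iso (breakupProj k P) breakupProj_eq_of_homotopic (zeros.isSheaf P)
    ⟨fun {U} v ↦ ?_⟩ ⟨?_⟩
  · refine mem_nisnevich_of_opens fun x ↦ ?_
    obtain ⟨D, hx, hD⟩ := exists_opens_isUnit (zeros.val v) x
    obtain ⟨w, hw, -⟩ := exists_lift_breakup ((zeros k P).map (U.opensι D).op v) hD
    exact ⟨D, hx, Quot.mk _ w, hw⟩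
  · rintro U ⟨w₁⟩ ⟨w₂⟩ h
    refine mem_nisnevich_of_opens fun x ↦ ?_
    let v := (breakupProj k P).app U w₁
    have h₂ : (breakupProj k P).app U w₂ = v := h.symm
    obtain ⟨D, hx, hD⟩ := exists_opens_isUnit (zeros.val v) x
    obtain ⟨w, -, hw⟩ := exists_lift_breakup ((zeros k P).map (U.unop.opensι D).op v) hD
    refine ⟨D, hx, ?_⟩
    exact (hw ((zeros k (breakup P)).map (U.unop.opensι D).op w₁) rfl).trans
      (hw ((zeros k (breakup P)).map (U.unop.opensι D).op w₂)
        (congrArg ((zeros k P).map (U.unop.opensι D).op) h₂)).symm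

/-! ### A smooth neighbourhood of an affine scheme -/

open MvPolynomial in
/-- The system expressing that all `1 + P i` are invertible; its solutions form an open subscheme
of affine space. -/
def neighbourhoodEq (P : ι → MvPolynomial σ ℤ) (i : ι) : MvPolynomial (σ ⊕ ι) ℤ :=
  (1 + rename .inl (P i)) * X (.inr i) - 1

lemma aeval_neighbourhoodEq {A : Type*} [CommRing A] (P : ι → MvPolynomial σ ℤ)
    (v : σ ⊕ ι → A) (i : ι) :
    MvPolynomial.aeval v (neighbourhoodEq P i) =
      (1 + MvPolynomial.aeval (fun j ↦ v (.inl j)) (P i)) * v (.inr i) - 1 := by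
  simp [neighbourhoodEq, MvPolynomial.aeval_rename, Function.comp_def]

/-- The solutions of `P` are the solutions of `neighbourhoodEq P` with all `1 + P i` equal
to `1`. -/
lemma exists_isPullback_neighbourhoodEq (P : ι → MvPolynomial σ ℤ) :
    ∃ (i : zeros k P ⟶ zeros k (neighbourhoodEq P)) (t : zeros k P ⟶ zeros k emptyEq)
      (r : zeros k (neighbourhoodEq P) ⟶ zeros k (unitEq ι))
      (e : zeros k emptyEq ⟶ zeros k (unitEq ι)), IsPullback i t r e ∧ Mono e := by
  let i : zeros k P ⟶ zeros k (neighbourhoodEq P) :=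
    { app U := TypeCat.ofHom fun v ↦ zeros.mk (U := U.unop)
        (Sum.elim (zeros.val v) fun _ ↦ 1) fun i ↦ by
          rw [aeval_neighbourhoodEq]
          simpa using zeros.aeval_val v i
      naturality U V f := by
        ext v
        refine zeros.ext ?_
        rintro (j | j)
        · rfl
        · exact (map_one (pull f.unop)).symm }
  let t : zeros k P ⟶ zeros k emptyEq :=
    { app U := TypeCat.ofHom fun v ↦ zeros.mk (U := U.unop) (fun j ↦ j.elim) fun i ↦ i.elim
      naturality U V f := by
        ext v
        exact zeros.ext fun j ↦ j.elim }
  let e : zeros k emptyEq ⟶ zeros k (unitEq ι) :=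
    { app U := TypeCat.ofHom fun v ↦ zeros.mk (U := U.unop) (fun _ ↦ 1) fun i ↦ by simp [unitEq]
      naturality U V f := by
        ext v
        exact zeros.ext fun j ↦ (map_one (pull f.unop)).symm }
  have hr {U : Sm k} (v : (zeros k (neighbourhoodEq P)).obj (op U)) (i : ι) :
      (1 + MvPolynomial.aeval (fun j ↦ zeros.val v (.inl j)) (P i)) * zeros.val v (.inr i) = 1 := by
    rw [← sub_eq_zero]
    exact (aeval_neighbourhoodEq P (zeros.val v) i).symm.trans (zeros.aeval_val v i)
  let r : zeros k (neighbourhoodEq P) ⟶ zeros k (unitEq ι) :=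
    { app U := TypeCat.ofHom fun v ↦ zeros.mk (U := U.unop) (Sum.elim
          (fun i ↦ 1 + MvPolynomial.aeval (fun j ↦ zeros.val v (.inl j)) (P i))
          fun i ↦ zeros.val v (.inr i)) fun i ↦ by
            simpa [unitEq, sub_eq_zero] using hr v i
      naturality U V f := by
        ext v
        refine zeros.ext ?_
        rintro (j | j)
        · refine Eq.trans ?_ (map_add (pull f.unop) 1 _).symm
          rw [map_one, map_aeval_int]
          rfl
        · rfl }
  refine ⟨i, t, r, e, .of_forall_isPullback_app fun U ↦ (Types.isPullback_iff _ _ _ _).mpr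
    ⟨?_, ?_, ?_⟩, ?_⟩
  · ext v
    refine zeros.ext ?_
    rintro (j | j)
    · change 1 + MvPolynomial.aeval (zeros.val v) (P j) = 1
      rw [zeros.aeval_val, add_zero]
    · rfl
  · rintro v w ⟨h, -⟩
    exact zeros.ext fun j ↦ congrArg (fun x ↦ zeros.val (P := neighbourhoodEq P) x (.inl j)) h
  · intro v x h
    have h₁ (j) : 1 + MvPolynomial.aeval (fun j ↦ zeros.val v (.inl j)) (P j) = 1 :=
      congrArg (fun x ↦ zeros.val (P := unitEq ι) x (.inl j)) h
    refine ⟨zeros.mk (U := U.unop) (fun j ↦ zeros.val v (.inl j)) fun i ↦ by simpa using h₁ i,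
      zeros.ext ?_, zeros.ext fun j ↦ j.elim⟩
    rintro (j | j)
    · rfl
    · exact (congrArg (fun x ↦ zeros.val (P := unitEq ι) x (.inr j)) h).symm
  · have (U : (Sm k)ᵒᵖ) : Mono (e.app U) := by
      rw [mono_iff_injective]
      exact fun _ _ _ ↦ zeros.ext fun j ↦ j.elim
    exact NatTrans.mono_of_mono_app e

/-- The functions `1 + P i` map the solutions of `neighbourhoodEq P` to a rigid sheaf of units, with
fibre `zeros k P` over `1`. -/
lemma Collapses.neighbourhoodEq {P : ι → MvPolynomial σ ℤ} {n : ℕ}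
    (h : Collapses (naiveIter (zeros k P) n)) :
    Collapses (naiveIter (zeros k (neighbourhoodEq P)) n) := by
  obtain ⟨i, t, r, e, H, he⟩ := exists_isPullback_neighbourhoodEq (k := k) P
  exact h.of_isPullback isRigid_emptyEq isRigid_unitEq (zeros.isSheaf _) (zeros.isSheaf _) he H

end

variable {σ ι : Type} {k : Type} [Field k]

open scoped AlgebraicGeometry in
lemma smooth_affineSpace [Finite σ] (X : Scheme.{0}) : Smooth (𝔸(σ; X) ↘ X) := by
  have h₁ := isIso_of_isTerminal specULiftZIsTerminal.{0} terminalIsTerminal (terminal.from _)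
  have h₂ : Smooth (Spec.map (CommRingCat.ofHom
      (MvPolynomial.C : ULift.{0} ℤ →+* MvPolynomial σ (ULift.{0} ℤ)))) := by
    rw [HasRingHomProperty.Spec_iff (P := @Smooth)]
    exact RingHom.smooth_algebraMap.mpr {}
  have h₃ : Smooth (terminal.from
      (Spec (CommRingCat.of (MvPolynomial σ (ULift.{0} ℤ))))) := by
    rw [← terminal.comp_from (Spec.map (CommRingCat.ofHom MvPolynomial.C))]
    infer_instance
  exact inferInstanceAs (Smooth (pullback.fst _ _))

variable (σ k) in
/-- Affine space over `k` as a smooth scheme of finite type. -/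
def affineSpace [Finite σ] : Sm k :=
  Sm.mk (𝔸(σ; Spec (CommRingCat.of k)) ↘ Spec (CommRingCat.of k)) (smooth_affineSpace _)
    inferInstance

/-- The coordinate functions on affine space. -/
def affineCoord [Finite σ] (j : σ) : Fn (affineSpace σ k) :=
  AffineSpace.coord (Spec (CommRingCat.of k)) j

/-- The morphism to affine space with given components. -/
def affineLift [Finite σ] {U : Sm k} (v : σ → Fn U) : U ⟶ affineSpace σ k :=
  MorphismProperty.Over.homMk (AffineSpace.homOfVector U.hom v)
    (AffineSpace.homOfVector_over _ _) trivial

lemma pull_affineLift [Finite σ] {U : Sm k} (v : σ → Fn U) (j : σ) :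
    pull (affineLift v) (affineCoord j) = v j :=
  AffineSpace.homOfVector_appTop_coord _ _ _

lemma affineSpace_hom_ext [Finite σ] {U : Sm k} {f g : U ⟶ affineSpace σ k}
    (h : ∀ j, pull f (affineCoord j) = pull g (affineCoord j)) : f = g := by
  ext : 1
  exact AffineSpace.hom_ext ((MorphismProperty.Over.w f).trans (MorphismProperty.Over.w g).symm) h

/-- The open subscheme of affine space on which all `1 + P i` are invertible. -/
def neighbourhood [Finite σ] [Fintype ι] (P : ι → MvPolynomial σ ℤ) : Sm k :=
  (affineSpace σ k).opens (Scheme.basicOpen _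
    (∏ i, (1 + MvPolynomial.aeval affineCoord (P i) : Fn (affineSpace σ k))))

lemma exists_lift_basicOpen {X Y : Scheme.{u}} (f : Y ⟶ X) {a : Γ(X, ⊤)}
    (h : IsUnit (f.appTop a)) : ∃ g : Y ⟶ X.basicOpen a, g ≫ (X.basicOpen a).ι = f := by
  refine ⟨IsOpenImmersion.lift (X.basicOpen a).ι f ?_, IsOpenImmersion.lift_fac _ _ _⟩
  rw [Scheme.Opens.range_ι]
  rintro _ ⟨y, rfl⟩
  have : y ∈ f ⁻¹ᵁ X.basicOpen a := by
    rw [Scheme.preimage_basicOpen_top, Scheme.basicOpen_of_isUnit _ h]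
    trivial
  exact this

lemma exists_opensι_comp {U V : Sm k} (f : V ⟶ U) {a : Fn U} (h : IsUnit (pull f a)) :
    ∃ g : V ⟶ U.opens (U.left.basicOpen a), g ≫ U.opensι _ = f := by
  obtain ⟨g, hg⟩ := exists_lift_basicOpen f.left h
  have hg' : g ≫ (U.opens (U.left.basicOpen a)).hom = V.hom := by
    refine Eq.trans ?_ (MorphismProperty.Over.w f)
    exact (Category.assoc _ _ _).symm.trans (congrArg (· ≫ U.hom) hg)
  refine ⟨MorphismProperty.Over.homMk g hg' trivial, ?_⟩
  ext : 1
  exact hg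

lemma opensι_cancel {U V : Sm k} {D : U.left.Opens} {f g : V ⟶ U.opens D}
    (h : f ≫ U.opensι D = g ≫ U.opensι D) : f = g := by
  ext : 1
  exact (cancel_mono D.ι).mp congr(($h).left)

/-- The open subscheme `neighbourhood P` represents the solutions of `neighbourhoodEq P`, the extra
variables being the inverses of the functions `1 + P i`. -/
lemma nonempty_represented_neighbourhood_iso [Finite σ] [Fintype ι] (P : ι → MvPolynomial σ ℤ) :
    Nonempty (represented (neighbourhood (k := k) P) ≅ zeros k (neighbourhoodEq P)) := by
  let A := affineSpace σ k
  let a (i : ι) : Fn A := 1 + MvPolynomial.aeval affineCoord (P i)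
  let Z := neighbourhood (k := k) P
  let p : Z ⟶ A := A.opensι _
  have ha {U : Sm k} (f : U ⟶ A) (i : ι) :
      pull f (a i) = 1 + MvPolynomial.aeval (fun j ↦ pull f (affineCoord j)) (P i) := by
    rw [← map_aeval_int]
    exact (map_add _ _ _).trans (congrArg (· + _) (map_one _))
  have hu : IsUnit (pull p (∏ i, a i)) := isUnit_pull_opensι le_rfl
  rw [map_prod, IsUnit.prod_univ_iff] at hu
  choose b hb using fun i ↦ (hu i).exists_right_inv
  let z : (zeros k (neighbourhoodEq P)).obj (op Z) :=
    zeros.mk (Sum.elim (fun j ↦ pull p (affineCoord j)) b) fun i ↦ by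
      rw [aeval_neighbourhoodEq, sub_eq_zero]
      exact (congrArg (· * b i) (ha p i).symm).trans (hb i)
  let φ : represented Z ⟶ zeros k (neighbourhoodEq P) := uliftYonedaEquiv.symm z
  have hφ' {U : Sm k} (f : U ⟶ Z) (j : σ) :
      zeros.val (φ.app (op U) ⟨f⟩) (.inl j) = pull (f ≫ p) (affineCoord j) :=
    pull_pull p f _
  have hb' {U : Sm k} (v : (zeros k (neighbourhoodEq P)).obj (op U)) (i : ι) :
      (1 + MvPolynomial.aeval (fun j ↦ zeros.val v (.inl j)) (P i)) * zeros.val v (.inr i) = 1 := by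
    rw [← sub_eq_zero]
    exact (aeval_neighbourhoodEq P (zeros.val v) i).symm.trans (zeros.aeval_val v i)
  suffices ∀ U : (Sm k)ᵒᵖ, IsIso (φ.app U) from
    have := (NatTrans.isIso_iff_isIso_app φ).mpr this
    ⟨asIso φ⟩
  intro U
  rw [isIso_iff_bijective]
  constructor
  · rintro ⟨f⟩ ⟨g⟩ h
    refine congrArg ULift.up (opensι_cancel (affineSpace_hom_ext fun j ↦ ?_))
    exact (hφ' f j).symm.trans ((congrArg (fun x ↦ zeros.val x (.inl j)) h).trans (hφ' g j))
  · intro v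
    let f : U.unop ⟶ A := affineLift fun j ↦ zeros.val v (.inl j)
    have hf (j) : pull f (affineCoord j) = zeros.val v (.inl j) := pull_affineLift _ j
    have hfu : IsUnit (pull f (∏ i, a i)) := by
      rw [map_prod, IsUnit.prod_univ_iff]
      intro i
      rw [ha]
      simp only [hf]
      exact .of_mul_eq_one _ (hb' v i)
    obtain ⟨g, hg⟩ := exists_opensι_comp f hfu
    have hgf (j) : zeros.val (φ.app U ⟨g⟩) (.inl j) = zeros.val v (.inl j) :=
      (hφ' g j).trans ((congrArg (fun h ↦ pull h (affineCoord j)) hg).trans (hf j))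
    refine ⟨⟨g⟩, zeros.ext ?_⟩
    rintro (j | i)
    · exact hgf j
    · have h₁ := hb' (φ.app U ⟨g⟩) i
      simp only [hgf] at h₁
      exact (IsUnit.of_mul_eq_one _ h₁).mul_left_cancel (h₁.trans (hb' v i).symm)

lemma isSeparated_ι_comp {X S : Scheme.{u}} (D : X.Opens) {p : X ⟶ S} (hp : IsSeparated p) :
    IsSeparated (D.ι ≫ p) :=
  inferInstance

lemma isIntegral_of_nonempty_opens {X : Scheme.{u}} (hX : IsIntegral X) (D : X.Opens)
    (hD : Nonempty D.toScheme) : IsIntegral D.toScheme :=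
  isIntegral_of_isOpenImmersion D.ι

lemma isSeparated_neighbourhood [Finite σ] [Fintype ι] (P : ι → MvPolynomial σ ℤ) :
    IsSeparated (neighbourhood (k := k) P).hom :=
  isSeparated_ι_comp _ (inferInstanceAs
    (IsSeparated (AffineSpace.over σ (Spec (CommRingCat.of k))).hom))

lemma isIntegral_neighbourhood [Finite σ] [Fintype ι] {P : ι → MvPolynomial σ ℤ} {v : σ → k}
    (hv : ∀ i, MvPolynomial.aeval v (P i) = 0) : IsIntegral (neighbourhood (k := k) P).left := by
  let c : k →+* Fn (Sm.point k) := (Scheme.ΓSpecIso (CommRingCat.of k)).inv.hom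
  let z : (zeros k (neighbourhoodEq P)).obj (op (Sm.point k)) :=
    zeros.mk (Sum.elim (fun j ↦ c (v j)) fun _ ↦ 1) fun i ↦ by
      rw [aeval_neighbourhoodEq]
      simp [← map_aeval_int, hv]
  obtain ⟨e⟩ := nonempty_represented_neighbourhood_iso (k := k) P
  let f : Sm.point k ⟶ neighbourhood P := ULift.down (e.inv.app _ z)
  refine isIntegral_of_nonempty_opens ?_ _
    ⟨f.left (Classical.arbitrary (Spec (CommRingCat.of k)))⟩
  exact inferInstanceAs (IsIntegral (AffineSpace σ (Spec (CommRingCat.of k))))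

lemma exists_aeval_breakup_eq_zero {P : ι → MvPolynomial σ ℤ} {v : σ → k}
    (hv : ∀ i, MvPolynomial.aeval v (P i) = 0) :
    ∃ w : σ ⊕ (σ ⊕ σ) → k, ∀ i, MvPolynomial.aeval w (breakup P i) = 0 := by
  refine ⟨_, aeval_breakup_eq_zero (x := fun j ↦ (v j - 1)⁻¹) (y := fun j ↦ (v j)⁻¹) hv
    fun j ↦ ?_⟩
  -- The second factor vanishes if `v j = 0`, and the first one otherwise.
  by_cases h : v j = 0
  · simp [h]
  · simp [h]

variable (k) in
/-- Breaking up the affine line `n` times delays the collapse of its points to the `n`-th stage. The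
`k`-rational solution `v` ensures that the neighbourhood of the solutions in affine space is not
empty. -/
lemma exists_collapses_naiveIter (n : ℕ) :
    ∃ (σ ι : Type) (_ : Finite σ) (_ : Fintype ι) (P : ι → MvPolynomial σ ℤ),
      (∃ v : σ → k, ∀ i, MvPolynomial.aeval v (P i) = 0) ∧
        Collapses (naiveIter (zeros k P) n) := by
  induction n with
  | zero =>
    exact ⟨Unit, Empty, inferInstance, inferInstance, freeEq, ⟨0, fun i ↦ i.elim⟩,
      collapses_freeEq⟩
  | succ n ih =>
    obtain ⟨σ, ι, _, _, P, ⟨v, hv⟩, h⟩ := ih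
    have := Fintype.ofFinite σ
    obtain ⟨e⟩ := nonempty_naive_breakup_iso (k := k) P
    exact ⟨σ ⊕ (σ ⊕ σ), ι ⊕ σ, inferInstance, inferInstance, breakup P,
      exists_aeval_breakup_eq_zero hv, .naiveIter_succ e h⟩

end AOne

end

theorem mainTheorem2 (n : ℕ) :
    ∃ Z : AOne.Sm ℂ, AlgebraicGeometry.IsIntegral Z.left ∧ AlgebraicGeometry.IsSeparated Z.hom ∧
      ¬ Function.Injective
        ((AOne.naiveIterSucc (AOne.represented Z) n).app (op (AOne.Sm.point ℂ))) := by
  obtain ⟨σ, ι, _, _, P, ⟨v, hv⟩, h⟩ := AOne.exists_collapses_naiveIter ℂ n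
  obtain ⟨e⟩ := AOne.nonempty_represented_neighbourhood_iso (k := ℂ) P
  exact ⟨AOne.neighbourhood P, AOne.isIntegral_neighbourhood hv, AOne.isSeparated_neighbourhood P,
    h.neighbourhoodEq.of_iso (AOne.naiveIterIso e.symm n)⟩
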